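/- **Theorem 1.1.** Let $A$ be a unital C*-algebra, let $G$ be a discrete group acting on $A$ by *-automorphisms, and let $A \rtimes_u G$ be the universal crossed product, generated by $A$ and the canonical unitaries $t \in G$; let $G$ act on it by $s\cdot(at) = (s\cdot a)\,(sts^{-1})$. Let $\tau$ be a $G$-invariant tracial state on $A$, let $\pi : A \to B(H_\tau)$ be its GNS representation, let $M = \pi(A)''$, let $\tau_M$ be the faithful normal tracial state on $M$ with $\tau_M\circ\pi = \tau$, and let $G$ act on $M$ by the *-automorphisms determined by $t\cdot\pi(a) = \pi(t\cdot a)$. Then the following three sets are in natural bijection with each other: 1. the set of all pseudoexpectations for $(A,\tau,G)$, that is, of all unital completely positive $G$-equivariant maps $F : A\rtimes_u G \to M$ with $F|_A = \pi$; 2. the set of all families $\{x_t\}_{t\in G} \subseteq M$ such that (a) $x_e = 1$; (b) $x_t y = (t\cdot y)\,x_t$ for all $y\in M$ and $t\in G$; (c) $s\cdot x_t = x_{sts^{-1}}$ for all $s,t\in G$; (d) for every finite $E\subseteq G$ the matrix $[x_{st^{-1}}]_{s,t\in E}$ over $M$ is positive; 3. the set of all tracial states $\sigma$ on $A\rtimes_u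 G$ with $\sigma|_A = \tau$. The bijection from (1) to (2) is given by $x_t = F(t)$, and the bijection from (2) to (3) sends $\{x_t\}$ to the tracial state $\sigma$ determined by $\sigma(at) = \tau_M(\pi(a)x_t)$ for $a\in A$ and $t\in G$. -/

import Mathlib

universe u v

section AlgebraicCrossedProduct

variable {A : Type u} {G : Type v} [CStarAlgebra A] [Group G]

/-- The action of `G` on `A` given by `α`, as a multiplicative action by ring automorphisms. -/
abbrev dynAction (α : G →* (A ≃⋆ₐ[ℂ] A)) : MulSemiringAction G A where
  smul t a := α t a
  one_smul a := by change α 1 a = a; simp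
  mul_smul s t a := by change α (s * t) a = α s (α t a); simp
  smul_zero t := map_zero (α t)
  smul_add t := map_add (α t)
  smul_one t := map_one (α t)
  smul_mul t := map_mul (α t)

/-- The *-algebra `A[G]` of finitely supported functions `∑ aₜ t` from `G` to `A`, with the
twisted multiplication `(a s) (b t) = (a (s · b)) (s t)`. -/
def AlgCrossedProduct (_α : G →* (A ≃⋆ₐ[ℂ] A)) : Type (max u v) := SkewMonoidAlgebra A G

namespace AlgCrossedProduct

variable (α : G →* (A ≃⋆ₐ[ℂ] A))

noncomputable instance : Ring (AlgCrossedProduct α) :=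
  letI := dynAction α
  inferInstanceAs (Ring (SkewMonoidAlgebra A G))

noncomputable instance : Module ℂ (AlgCrossedProduct α) :=
  inferInstanceAs (Module ℂ (SkewMonoidAlgebra A G))

/-- The element `a t` of `A[G]`. -/
noncomputable def single (t : G) (a : A) : AlgCrossedProduct α := SkewMonoidAlgebra.single t a

theorem single_add (t : G) (a b : A) : single α t (a + b) = single α t a + single α t b :=
  SkewMonoidAlgebra.single_add t a b

theorem single_zero (t : G) : single α t 0 = 0 :=
  SkewMonoidAlgebra.single_zero t

theorem smul_single (c : ℂ) (t : G) (a : A) : c • single α t a = single α t (c • a) :=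
  SkewMonoidAlgebra.smul_single c t a

theorem one_def : (1 : AlgCrossedProduct α) = single α 1 1 := rfl

theorem single_mul_single (s t : G) (a b : A) :
    single α s a * single α t b = single α (s * t) (a * α s b) :=
  letI := dynAction α
  SkewMonoidAlgebra.single_mul_single

variable {α} in
theorem induction {p : AlgCrossedProduct α → Prop} (x : AlgCrossedProduct α)
    (hz : p 0) (hs : ∀ t a, p (single α t a)) (ha : ∀ x y, p x → p y → p (x + y)) : p x :=
  SkewMonoidAlgebra.induction_on (p := p) x hz hs (fun x y => ha x y)

noncomputable instance : Algebra ℂ (AlgCrossedProduct α) :=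
  Algebra.ofModule
    (fun c x y => by
      induction x using induction with
      | hz => simp
      | ha x x' hx hx' => simp only [smul_add, add_mul, hx, hx']
      | hs s a =>
        induction y using induction with
        | hz => simp
        | ha x x' hx hx' => simp only [smul_add, mul_add, hx, hx']
        | hs t b => simp only [smul_single, single_mul_single, smul_mul_assoc])
    (fun c x y => by
      induction x using induction with
      | hz => simp
      | ha x x' hx hx' => simp only [smul_add, add_mul, hx, hx']
      | hs s a =>
        induction y using induction with
        | hz => simp
        | ha x x' hx hx' => simp only [smul_add, mul_add, hx, hx']
        | hs t b => simp only [smul_single, single_mul_single, map_smul, mul_smul_comm])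

/-- The additive map on `A[G]` determined by its values on the elements `a t`. -/
noncomputable def liftAdd {N : Type*} [AddCommMonoid N] (φ : G → A →+ N) :
    AlgCrossedProduct α →+ N where
  toFun x := SkewMonoidAlgebra.sum x fun t a => φ t a
  map_zero' := SkewMonoidAlgebra.sum_zero_index
  map_add' x y := by
    classical
    exact SkewMonoidAlgebra.sum_add_index (by simp) (by simp)

@[simp]
theorem liftAdd_single {N : Type*} [AddCommMonoid N] (φ : G → A →+ N) (t : G) (a : A) :
    liftAdd α φ (single α t a) = φ t a :=
  SkewMonoidAlgebra.sum_single_index (by simp)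

/-- The involution `(a t)^* = (t⁻¹ · a^*) t⁻¹` of `A[G]`. -/
noncomputable def starHom : AlgCrossedProduct α →+ AlgCrossedProduct α :=
  liftAdd α fun t =>
    { toFun a := single α t⁻¹ (α t⁻¹ (star a))
      map_zero' := by simp [single_zero]
      map_add' a b := by simp [single_add] }

noncomputable instance : Star (AlgCrossedProduct α) := ⟨starHom α⟩

theorem star_single (t : G) (a : A) :
    star (single α t a) = single α t⁻¹ (α t⁻¹ (star a)) :=
  liftAdd_single α _ t a

theorem star_add_aux (x y : AlgCrossedProduct α) : star (x + y) = star x + star y :=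
  map_add (starHom α) x y

theorem star_zero_aux : star (0 : AlgCrossedProduct α) = 0 := map_zero (starHom α)

noncomputable instance : StarRing (AlgCrossedProduct α) where
  star_involutive x := by
    induction x using induction with
    | hz => simp only [star_zero_aux]
    | hs t a =>
      have h : α t (α t⁻¹ a) = a := by
        rw [← StarAlgEquiv.mul_apply, ← map_mul]; simp
      rw [star_single, star_single, ← map_star, star_star, inv_inv, h]
    | ha x y hx hy => rw [star_add_aux, star_add_aux, hx, hy]
  star_add := star_add_aux α
  star_mul x y := by
    induction x using induction with
    | hz => simp only [star_zero_aux, zero_mul, mul_zero]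
    | ha x x' hx hx' => rw [add_mul, star_add_aux, star_add_aux, hx, hx', mul_add]
    | hs s a =>
      induction y using induction with
      | hz => simp only [star_zero_aux, zero_mul, mul_zero]
      | ha x x' hx hx' => rw [mul_add, star_add_aux, star_add_aux, hx, hx', add_mul]
      | hs t b =>
        have h : α s⁻¹ (α s (star b)) = star b := by
          rw [← StarAlgEquiv.mul_apply, ← map_mul]; simp
        simp only [star_single, single_mul_single, mul_inv_rev, star_mul, map_mul,
          StarAlgEquiv.mul_apply, ← map_star, h]

instance : StarModule ℂ (AlgCrossedProduct α) where
  star_smul c x := by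
    induction x using induction with
    | hz => simp
    | hs t a => simp only [smul_single, star_single, star_smul, map_smul]
    | ha x y hx hy => simp only [smul_add, star_add, hx, hy]

end AlgCrossedProduct

/-- A covariant representation of `(A, G, α)` on a Hilbert space: a unital *-representation `π`
of `A` and a unitary representation `U` of `G` with `Uₜ π(a) = π(t · a) Uₜ`. The universe of `H`
contains, up to unitary equivalence, all cyclic covariant representations. -/
structure CovariantRep (α : G →* (A ≃⋆ₐ[ℂ] A)) where
  /-- the Hilbert space -/
  H : Type (max u v)
  [normed : NormedAddCommGroup H]
  [inner : InnerProductSpace ℂ H]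
  [complete : CompleteSpace H]
  /-- the representation of `A` -/
  π : A →⋆ₐ[ℂ] (H →L[ℂ] H)
  /-- the unitary representation of `G` -/
  U : G →* unitary (H →L[ℂ] H)
  covariant (t : G) (a : A) : (U t : H →L[ℂ] H) * π a = π (α t a) * (U t : H →L[ℂ] H)

attribute [instance] CovariantRep.normed CovariantRep.inner CovariantRep.complete

namespace CovariantRep

variable {α : G →* (A ≃⋆ₐ[ℂ] A)} (r : CovariantRep α)

/-- The integrated form `∑ aₜ t ↦ ∑ π(aₜ) Uₜ` of a covariant representation. -/
noncomputable def integrated : AlgCrossedProduct α →+ (r.H →L[ℂ] r.H) :=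
  AlgCrossedProduct.liftAdd α fun t =>
    { toFun a := r.π a * (r.U t : r.H →L[ℂ] r.H)
      map_zero' := by simp
      map_add' a b := by simp [add_mul] }

theorem integrated_single (t : G) (a : A) :
    r.integrated (AlgCrossedProduct.single α t a) = r.π a * (r.U t : r.H →L[ℂ] r.H) :=
  AlgCrossedProduct.liftAdd_single α _ t a

theorem integrated_one : r.integrated 1 = 1 := by
  rw [AlgCrossedProduct.one_def, integrated_single]; simp

theorem integrated_mul (x y : AlgCrossedProduct α) :
    r.integrated (x * y) = r.integrated x * r.integrated y := by
  induction x using AlgCrossedProduct.induction with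
  | hz => simp
  | ha x x' hx hx' => simp only [add_mul, map_add, hx, hx']
  | hs s a =>
    induction y using AlgCrossedProduct.induction with
    | hz => simp
    | ha x x' hx hx' => simp only [mul_add, map_add, hx, hx']
    | hs t b =>
      simp only [AlgCrossedProduct.single_mul_single, integrated_single, map_mul,
        Submonoid.coe_mul, mul_assoc]
      rw [← mul_assoc (r.U s : r.H →L[ℂ] r.H), r.covariant, mul_assoc]

theorem integrated_star (x : AlgCrossedProduct α) :
    r.integrated (star x) = star (r.integrated x) := by
  induction x using AlgCrossedProduct.induction with
  | hz => simp
  | ha x x' hx hx' => simp only [star_add, map_add, hx, hx']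
  | hs s a =>
    rw [AlgCrossedProduct.star_single, integrated_single, integrated_single, ← r.covariant,
      star_mul, ← map_star, map_inv]
    rfl

theorem integrated_smul (c : ℂ) (x : AlgCrossedProduct α) :
    r.integrated (c • x) = c • r.integrated x := by
  induction x using AlgCrossedProduct.induction with
  | hz => simp
  | ha x x' hx hx' => simp only [smul_add, map_add, hx, hx']
  | hs s a => simp only [AlgCrossedProduct.smul_single, integrated_single, map_smul, smul_mul_assoc]

theorem norm_unitary_le_one (t : G) : ‖(r.U t : r.H →L[ℂ] r.H)‖ ≤ 1 := by
  nontriviality (r.H →L[ℂ] r.H)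
  exact (CStarRing.norm_of_mem_unitary (r.U t).2).le

end CovariantRep


namespace AlgCrossedProduct

variable {α : G →* (A ≃⋆ₐ[ℂ] A)}

theorem exists_norm_integrated_le (x : AlgCrossedProduct α) :
    ∃ C : ℝ, ∀ r : CovariantRep α, ‖r.integrated x‖ ≤ C := by
  induction x using induction with
  | hz => exact ⟨0, fun r => by simp⟩
  | hs t a =>
    refine ⟨‖a‖, fun r => ?_⟩
    rw [r.integrated_single]
    calc _ ≤ ‖r.π a‖ * ‖(r.U t : r.H →L[ℂ] r.H)‖ := norm_mul_le _ _
      _ ≤ ‖a‖ * 1 := by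
        gcongr
        · exact NonUnitalStarAlgHom.norm_apply_le r.π a
        · exact r.norm_unitary_le_one t
      _ = ‖a‖ := mul_one _
  | ha x y hx hy =>
    obtain ⟨C, hC⟩ := hx
    obtain ⟨D, hD⟩ := hy
    refine ⟨C + D, fun r => ?_⟩
    rw [map_add]
    exact (norm_add_le _ _).trans (add_le_add (hC r) (hD r))

/-- The universal norm `‖x‖ᵤ`: the supremum of the norms of the images of `x` under the integrated
forms of all covariant representations. -/
noncomputable def unorm (x : AlgCrossedProduct α) : ℝ := ⨆ r : CovariantRep α, ‖r.integrated x‖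

theorem norm_integrated_le (r : CovariantRep α) (x : AlgCrossedProduct α) :
    ‖r.integrated x‖ ≤ unorm x := by
  obtain ⟨C, hC⟩ := exists_norm_integrated_le x
  exact le_ciSup (f := fun r : CovariantRep α => ‖r.integrated x‖)
    ⟨C, by rintro _ ⟨r, rfl⟩; exact hC r⟩ r

theorem unorm_nonneg (x : AlgCrossedProduct α) : 0 ≤ unorm x :=
  Real.iSup_nonneg fun _ => norm_nonneg _

theorem unorm_le {x : AlgCrossedProduct α} {C : ℝ} (hC : 0 ≤ C)
    (h : ∀ r : CovariantRep α, ‖r.integrated x‖ ≤ C) : unorm x ≤ C :=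
  Real.iSup_le h hC

theorem unorm_mul_le (x y : AlgCrossedProduct α) : unorm (x * y) ≤ unorm x * unorm y := by
  refine unorm_le (mul_nonneg (unorm_nonneg x) (unorm_nonneg y)) fun r => ?_
  rw [r.integrated_mul]
  exact (norm_mul_le _ _).trans (mul_le_mul (norm_integrated_le r x) (norm_integrated_le r y)
    (norm_nonneg _) (unorm_nonneg x))

noncomputable instance : SeminormedRing (AlgCrossedProduct α) :=
  RingSeminorm.toSeminormedRing
    { toFun := unorm
      map_zero' := le_antisymm (unorm_le le_rfl fun r => by simp) (unorm_nonneg _)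
      add_le' x y := unorm_le (add_nonneg (unorm_nonneg x) (unorm_nonneg y)) fun r => by
        rw [map_add]
        exact (norm_add_le _ _).trans
          (add_le_add (norm_integrated_le r x) (norm_integrated_le r y))
      neg' x := by simp [unorm]
      mul_le' := unorm_mul_le }

theorem norm_def (x : AlgCrossedProduct α) : ‖x‖ = ⨆ r : CovariantRep α, ‖r.integrated x‖ := rfl

noncomputable instance : NormedAlgebra ℂ (AlgCrossedProduct α) where
  norm_smul_le c x := unorm_le (mul_nonneg (norm_nonneg c) (unorm_nonneg x)) fun r => by
    rw [r.integrated_smul, norm_smul]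
    exact mul_le_mul_of_nonneg_left (norm_integrated_le r x) (norm_nonneg c)

theorem norm_star_le (x : AlgCrossedProduct α) : ‖star x‖ ≤ ‖x‖ :=
  unorm_le (unorm_nonneg x) fun r => by
    rw [r.integrated_star, norm_star]
    exact norm_integrated_le r x

instance : NormedStarGroup (AlgCrossedProduct α) where
  norm_star_le := norm_star_le

theorem norm_mul_self_le (x : AlgCrossedProduct α) : ‖x‖ * ‖x‖ ≤ ‖star x * x‖ := by
  have h : ‖x‖ ≤ √‖star x * x‖ := unorm_le (Real.sqrt_nonneg _) fun r => by
    apply Real.le_sqrt_of_sq_le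
    rw [sq, ← CStarRing.norm_star_mul_self, ← r.integrated_star, ← r.integrated_mul]
    exact norm_integrated_le r _
  calc ‖x‖ * ‖x‖ ≤ √‖star x * x‖ * √‖star x * x‖ := by gcongr
    _ = _ := Real.mul_self_sqrt (norm_nonneg _)

end AlgCrossedProduct

/-- The universal crossed product `A ⋊ᵤ G`: the completion of `A[G]` in the universal norm. -/
def CrossedProduct (α : G →* (A ≃⋆ₐ[ℂ] A)) : Type (max u v) :=
  UniformSpace.Completion (AlgCrossedProduct α)

namespace CrossedProduct

open UniformSpace

variable (α : G →* (A ≃⋆ₐ[ℂ] A))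

noncomputable instance : NormedRing (CrossedProduct α) :=
  inferInstanceAs (NormedRing (Completion (AlgCrossedProduct α)))

instance : CompleteSpace (CrossedProduct α) :=
  inferInstanceAs (CompleteSpace (Completion (AlgCrossedProduct α)))

/-- The canonical map `A[G] → A ⋊ᵤ G`. -/
noncomputable def ofAlg : AlgCrossedProduct α →+* CrossedProduct α :=
  Completion.coeRingHom

theorem norm_ofAlg (x : AlgCrossedProduct α) : ‖ofAlg α x‖ = ‖x‖ := Completion.norm_coe x

theorem denseRange_ofAlg : DenseRange (ofAlg α) := Completion.denseRange_coe

variable {α} in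
theorem induction {p : CrossedProduct α → Prop} (x : CrossedProduct α)
    (hc : IsClosed {x | p x}) (h : ∀ y, p (ofAlg α y)) : p x :=
  Completion.induction_on x hc h

noncomputable instance : Algebra ℂ (CrossedProduct α) :=
  inferInstanceAs (Algebra ℂ (Completion (AlgCrossedProduct α)))

theorem ofAlg_smul (c : ℂ) (x : AlgCrossedProduct α) : ofAlg α (c • x) = c • ofAlg α x :=
  Completion.coe_smul c x

noncomputable instance : NormedAlgebra ℂ (CrossedProduct α) where
  norm_smul_le := norm_smul_le (α := ℂ) (β := Completion (AlgCrossedProduct α))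

/-- The involution of `A ⋊ᵤ G`, extending that of `A[G]` by continuity. -/
noncomputable instance : Star (CrossedProduct α) :=
  ⟨Completion.map (star : AlgCrossedProduct α → AlgCrossedProduct α)⟩

theorem continuous_star' : Continuous (star : CrossedProduct α → CrossedProduct α) :=
  Completion.continuous_map

theorem star_ofAlg (x : AlgCrossedProduct α) : star (ofAlg α x) = ofAlg α (star x) :=
  Completion.map_coe
    (LipschitzWith.uniformContinuous (K := 1) <| LipschitzWith.of_dist_le_mul fun x y => by
      simp [dist_eq_norm, ← star_sub]) x

noncomputable instance : StarRing (CrossedProduct α) where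
  star_involutive x := by
    induction x using induction with
    | hc => exact isClosed_eq ((continuous_star' α).comp (continuous_star' α)) continuous_id
    | h x => simp [star_ofAlg]
  star_add x y := by
    refine (denseRange_ofAlg α).induction_on₂ (p := fun x y => star (x + y) = star x + star y)
      ?_ ?_ x y
    · have := continuous_star' α
      exact isClosed_eq (by fun_prop) (by fun_prop)
    · intro x y; simp [star_ofAlg, ← map_add]
  star_mul x y := by
    refine (denseRange_ofAlg α).induction_on₂ (p := fun x y => star (x * y) = star y * star x)
      ?_ ?_ x y
    · have := continuous_star' α
      exact isClosed_eq (by fun_prop) (by fun_prop)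
    · intro x y; simp [star_ofAlg, ← map_mul]

theorem star_smul_aux (c : ℂ) (x : CrossedProduct α) : star (c • x) = star c • star x := by
  induction x using induction with
  | hc =>
    exact isClosed_eq ((continuous_star' α).comp (continuous_const_smul c))
      ((continuous_const_smul (star c)).comp (continuous_star' α))
  | h x => rw [← ofAlg_smul, star_ofAlg, star_ofAlg, star_smul, ofAlg_smul]

instance : StarModule ℂ (CrossedProduct α) where
  star_smul := star_smul_aux α

instance : CStarRing (CrossedProduct α) where
  norm_mul_self_le x := by
    induction x using induction with
    | hc =>
      have := continuous_star' α
      exact isClosed_le (by fun_prop) (by fun_prop)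
    | h x =>
      simpa only [star_ofAlg, ← map_mul, norm_ofAlg] using AlgCrossedProduct.norm_mul_self_le x

noncomputable instance : CStarAlgebra (CrossedProduct α) where

/-- The usual order of a C*-algebra. -/
noncomputable instance : PartialOrder (CrossedProduct α) := CStarAlgebra.spectralOrder _

instance : StarOrderedRing (CrossedProduct α) := CStarAlgebra.spectralOrderedRing _

/-- The canonical map `A → A ⋊ᵤ G`. -/
noncomputable def ι : A →⋆ₐ[ℂ] CrossedProduct α where
  toFun a := ofAlg α (AlgCrossedProduct.single α 1 a)
  map_one' := by rw [← AlgCrossedProduct.one_def, map_one]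
  map_mul' a b := by rw [← map_mul, AlgCrossedProduct.single_mul_single]; simp
  map_zero' := by rw [AlgCrossedProduct.single_zero, map_zero]
  map_add' a b := by rw [AlgCrossedProduct.single_add, map_add]
  commutes' c := by
    rw [Algebra.algebraMap_eq_smul_one, Algebra.algebraMap_eq_smul_one,
      ← AlgCrossedProduct.smul_single, ← AlgCrossedProduct.one_def, ofAlg_smul, map_one]
  map_star' a := by rw [star_ofAlg, AlgCrossedProduct.star_single]; simp

/-- The canonical unitary of `A ⋊ᵤ G` corresponding to `t ∈ G`. -/
noncomputable def u : G →* unitary (CrossedProduct α) where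
  toFun t := ⟨ofAlg α (AlgCrossedProduct.single α t 1), by
    constructor <;>
    · rw [star_ofAlg, AlgCrossedProduct.star_single, ← map_mul,
        AlgCrossedProduct.single_mul_single]
      simp [← AlgCrossedProduct.one_def]⟩
  map_one' := by ext; simp [← AlgCrossedProduct.one_def]
  map_mul' s t := by
    ext
    simp [← map_mul, AlgCrossedProduct.single_mul_single]

theorem ι_mul_u (a : A) (t : G) :
    ι α a * (u α t : CrossedProduct α) = ofAlg α (AlgCrossedProduct.single α t a) := by
  change ofAlg α _ * ofAlg α _ = _
  rw [← map_mul, AlgCrossedProduct.single_mul_single]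
  simp

/-- The canonical action of `G` on `A ⋊ᵤ G`, given by `s · (a t) = (s · a) (s t s⁻¹)`; it is the
conjugation by the canonical unitaries. -/
noncomputable def action (s : G) : CrossedProduct α ≃⋆ₐ[ℂ] CrossedProduct α :=
  Unitary.conjStarAlgAut ℂ (CrossedProduct α) (u α s)

theorem action_ι_mul_u (s : G) (a : A) (t : G) :
    action α s (ι α a * (u α t : CrossedProduct α)) =
      ι α (α s a) * (u α (s * t * s⁻¹) : CrossedProduct α) := by
  rw [action, Unitary.conjStarAlgAut_apply, ι_mul_u, ι_mul_u]
  change ofAlg α _ * ofAlg α _ * star (ofAlg α _) = _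
  rw [star_ofAlg, AlgCrossedProduct.star_single, ← map_mul, ← map_mul,
    AlgCrossedProduct.single_mul_single, AlgCrossedProduct.single_mul_single]
  simp

end CrossedProduct

end AlgebraicCrossedProduct

section TracialGNS

open UniformSpace
open scoped ComplexOrder

/-- A tracial state on a unital C*-algebra. -/
structure TracialState (B : Type*) [CStarAlgebra B] [PartialOrder B] [StarOrderedRing B] where
  /-- the underlying positive linear functional -/
  toPositive : B →ₚ[ℂ] ℂ
  map_one' : toPositive 1 = 1
  map_mul_comm' (a b : B) : toPositive (a * b) = toPositive (b * a)

noncomputable instance {B : Type*} [CStarAlgebra B] [PartialOrder B] [StarOrderedRing B] :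
    CoeFun (TracialState B) fun _ => B → ℂ :=
  ⟨fun τ => τ.toPositive⟩

variable {A : Type u} {G : Type v} [CStarAlgebra A] [PartialOrder A] [StarOrderedRing A] [Group G]

/-- A tracial state on `A` that is invariant under the action `α` of `G`. -/
structure InvariantTrace (α : G →* (A ≃⋆ₐ[ℂ] A)) extends TracialState A where
  invariant (t : G) (a : A) : toPositive (α t a) = toPositive a

/-- The von Neumann algebra `π(A)″` generated by the GNS representation `π` of `f`. -/
noncomputable def gnsVonNeumann (f : A →ₚ[ℂ] ℂ) : VonNeumannAlgebra f.GNS where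
  toStarSubalgebra := StarSubalgebra.centralizer ℂ
    (StarSubalgebra.centralizer ℂ (Set.range f.gnsStarAlgHom) : Set (f.GNS →L[ℂ] f.GNS))
  centralizer_centralizer' := by
    let S : StarSubalgebra ℂ (f.GNS →L[ℂ] f.GNS) := StarSubalgebra.centralizer ℂ
      (StarSubalgebra.centralizer ℂ (Set.range f.gnsStarAlgHom) : Set (f.GNS →L[ℂ] f.GNS))
    change Set.centralizer (Set.centralizer (S : Set (f.GNS →L[ℂ] f.GNS))) = S
    rw [StarSubalgebra.coe_centralizer_centralizer, Set.centralizer_centralizer_centralizer]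

theorem star_range_gns (f : A →ₚ[ℂ] ℂ) :
    star (Set.range f.gnsStarAlgHom) = Set.range f.gnsStarAlgHom := by
  ext y
  rw [Set.mem_star]
  constructor
  · rintro ⟨a, ha⟩
    exact ⟨star a, by rw [map_star, ha, star_star]⟩
  · rintro ⟨a, rfl⟩
    exact ⟨star a, map_star _ _⟩

theorem coe_gnsVonNeumann (f : A →ₚ[ℂ] ℂ) :
    ((gnsVonNeumann f).toStarSubalgebra : Set (f.GNS →L[ℂ] f.GNS)) =
      Set.centralizer (Set.centralizer (Set.range f.gnsStarAlgHom)) := by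
  change SetLike.coe (StarSubalgebra.centralizer ℂ _) = _
  rw [StarSubalgebra.coe_centralizer_centralizer, star_range_gns, Set.union_self]

theorem isClosed_gnsVonNeumann (f : A →ₚ[ℂ] ℂ) :
    IsClosed ((gnsVonNeumann f).toStarSubalgebra : Set (f.GNS →L[ℂ] f.GNS)) := by
  rw [coe_gnsVonNeumann]
  exact Set.isClosed_centralizer _

theorem gnsStarAlgHom_mem (f : A →ₚ[ℂ] ℂ) (a : A) :
    f.gnsStarAlgHom a ∈ (gnsVonNeumann f).toStarSubalgebra := by
  rw [← SetLike.mem_coe, coe_gnsVonNeumann]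
  exact Set.subset_centralizer_centralizer ⟨a, rfl⟩

theorem gnsStarAlgHom_coe (f : A →ₚ[ℂ] ℂ) (a b : A) :
    f.gnsStarAlgHom a (f.toPreGNS b : f.PreGNS) = ((f.toPreGNS (a * b) : f.PreGNS) : f.GNS) :=
  f.gnsNonUnitalStarAlgHom_apply_coe

/-- An automorphism of a *-algebra that maps a *-subalgebra onto itself, restricted to it. -/
def restrictStarAlgEquiv {B : Type*} [Ring B] [StarRing B] [Algebra ℂ B] [StarModule ℂ B]
    (S : StarSubalgebra ℂ B) (e : B ≃⋆ₐ[ℂ] B) (h : ∀ y ∈ S, e y ∈ S) (h' : ∀ y ∈ S, e.symm y ∈ S) :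
    S ≃⋆ₐ[ℂ] S where
  toFun y := ⟨e y, h y y.2⟩
  invFun y := ⟨e.symm y, h' y y.2⟩
  left_inv _ := Subtype.ext (e.symm_apply_apply _)
  right_inv _ := Subtype.ext (e.apply_symm_apply _)
  map_add' _ _ := Subtype.ext (map_add e _ _)
  map_mul' _ _ := Subtype.ext (map_mul e _ _)
  map_star' _ := Subtype.ext (map_star e _)
  map_smul' c _ := Subtype.ext (map_smul e c _)

theorem starOrderedRing_of_isClosed {B : Type*} [CStarAlgebra B] [PartialOrder B]
    [StarOrderedRing B] (S : StarSubalgebra ℂ B) (hS : IsClosed (S : Set B)) :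
    StarOrderedRing S := by
  refine StarOrderedRing.of_nonneg_iff' (fun {x y} h z => ?_) fun x => ⟨fun h => ?_, ?_⟩
  · change (z : B) + x ≤ z + y
    have h' : (x : B) ≤ y := h
    gcongr
  · have h' : 0 ≤ (x : B) := h
    have hm : cfc Real.sqrt (x : B) ∈ S := cfc_mem (s := S) Real.sqrt x.2
    refine ⟨⟨_, hm⟩, Subtype.ext ?_⟩
    change (x : B) = star (cfc Real.sqrt (x : B)) * cfc Real.sqrt _
    rw [(cfc_predicate Real.sqrt (x : B)).star_eq, ← cfc_mul ..]
    conv_lhs => rw [← cfc_id ℝ (x : B)]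
    refine cfc_congr fun r hr => ?_
    exact (Real.mul_self_sqrt (spectrum_nonneg_of_nonneg h' hr)).symm
  · rintro ⟨s, rfl⟩
    exact star_mul_self_nonneg (s : B)

variable {α : G →* (A ≃⋆ₐ[ℂ] A)}

namespace InvariantTrace

variable (τ : InvariantTrace α)

/-- The GNS Hilbert space `H_τ`. -/
abbrev H : Type u := τ.toPositive.GNS

/-- The von Neumann algebra `M = π(A)″`. -/
def M : Type u := (gnsVonNeumann τ.toPositive).toStarSubalgebra

noncomputable instance : NormedRing τ.M :=
  inferInstanceAs (NormedRing (gnsVonNeumann τ.toPositive).toStarSubalgebra)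

noncomputable instance : StarRing τ.M :=
  inferInstanceAs (StarRing (gnsVonNeumann τ.toPositive).toStarSubalgebra)

noncomputable instance : NormedAlgebra ℂ τ.M :=
  inferInstanceAs (NormedAlgebra ℂ (gnsVonNeumann τ.toPositive).toStarSubalgebra)

instance : StarModule ℂ τ.M :=
  inferInstanceAs (StarModule ℂ (gnsVonNeumann τ.toPositive).toStarSubalgebra)

instance : CStarRing τ.M :=
  inferInstanceAs (CStarRing (gnsVonNeumann τ.toPositive).toStarSubalgebra)

instance : CompleteSpace τ.M :=
  (isClosed_gnsVonNeumann τ.toPositive).completeSpace_coe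

noncomputable instance : CStarAlgebra τ.M where

/-- The inclusion of `M` in the bounded operators on `H_τ`. -/
noncomputable def incl : τ.M →⋆ₐ[ℂ] (τ.H →L[ℂ] τ.H) :=
  (gnsVonNeumann τ.toPositive).toStarSubalgebra.subtype

/-- The order of `M`, inherited from the bounded operators on `H_τ`. -/
noncomputable instance : PartialOrder τ.M :=
  inferInstanceAs (PartialOrder (gnsVonNeumann τ.toPositive).toStarSubalgebra)

instance : StarOrderedRing τ.M :=
  starOrderedRing_of_isClosed _ (isClosed_gnsVonNeumann τ.toPositive)

/-- The GNS representation `π`, as a map from `A` to `M`. -/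
noncomputable def π : A →⋆ₐ[ℂ] τ.M :=
  τ.toPositive.gnsStarAlgHom.codRestrict (gnsVonNeumann τ.toPositive).toStarSubalgebra
    (gnsStarAlgHom_mem τ.toPositive)

theorem incl_π (a : A) : τ.incl (τ.π a) = τ.toPositive.gnsStarAlgHom a := rfl

/-- The canonical cyclic vector of `H_τ`, the class of `1 ∈ A`. -/
noncomputable def ξ : τ.H := ((τ.toPositive.toPreGNS 1 : τ.toPositive.PreGNS) : τ.H)

/-- The faithful normal trace `τ_M` on `M` with `τ_M ∘ π = τ`: the vector state at the canonical
cyclic vector. It is the only normal functional on `M` with `τ_M ∘ π = τ`. -/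
noncomputable def traceM (y : τ.M) : ℂ := inner ℂ τ.ξ (τ.incl y τ.ξ)

theorem traceM_π (a : A) : τ.traceM (τ.π a) = τ.toPositive a := by
  rw [traceM, incl_π, ξ, gnsStarAlgHom_coe, Completion.inner_coe,
    PositiveLinearMap.preGNS_inner_def]
  simp

/-- The isometry of the pre-Hilbert space `(A, ⟨a, b⟩ = τ(a^* b))` given by `a ↦ t · a`. -/
noncomputable def preIsometry (t : G) : τ.toPositive.PreGNS →ₗᵢ[ℂ] τ.toPositive.PreGNS :=
  LinearIsometry.mk
    (τ.toPositive.toPreGNS.toLinearMap ∘ₗ (α t : A →ₗ[ℂ] A) ∘ₗ τ.toPositive.ofPreGNS.toLinearMap)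
    fun x => by
      simp only [PositiveLinearMap.preGNS_norm_def, LinearMap.comp_apply, LinearEquiv.coe_coe,
        PositiveLinearMap.ofPreGNS_toPreGNS]
      change √(τ.toPositive (star (α t _) * α t _)).re = _
      rw [← map_star, ← map_mul, τ.invariant]

/-- The same isometry as a continuous linear map. -/
noncomputable def preU (t : G) : τ.toPositive.PreGNS →L[ℂ] τ.toPositive.PreGNS :=
  (τ.preIsometry t).toContinuousLinearMap

theorem preU_apply (t : G) (a : A) :
    τ.preU t (τ.toPositive.toPreGNS a) = τ.toPositive.toPreGNS (α t a) := rfl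

theorem norm_preU (t : G) (x : τ.toPositive.PreGNS) : ‖τ.preU t x‖ = ‖x‖ :=
  (τ.preIsometry t).norm_map x

theorem completion_preU_mul (s t : G) (x : τ.H) :
    (τ.preU (s * t)).completion x = (τ.preU s).completion ((τ.preU t).completion x) := by
  induction x using Completion.induction_on with
  | hp => exact isClosed_eq (by fun_prop) (by fun_prop)
  | ih x =>
    simp only [ContinuousLinearMap.completion_apply_coe]
    obtain ⟨a, rfl⟩ := τ.toPositive.toPreGNS.surjective x
    simp only [preU_apply, map_mul, StarAlgEquiv.mul_apply]

theorem completion_preU_one (x : τ.H) : (τ.preU 1).completion x = x := by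
  induction x using Completion.induction_on with
  | hp => exact isClosed_eq (by fun_prop) (by fun_prop)
  | ih x =>
    simp only [ContinuousLinearMap.completion_apply_coe]
    obtain ⟨a, rfl⟩ := τ.toPositive.toPreGNS.surjective x
    simp only [preU_apply, map_one, StarAlgEquiv.one_apply]

/-- The unitary of `H_τ` that implements `t ∈ G`; it maps the class of `a` to that of `t · a`. -/
noncomputable def U (t : G) : τ.H ≃ₗᵢ[ℂ] τ.H where
  toLinearEquiv := LinearEquiv.ofLinearMap ((τ.preU t).completion : τ.H →ₗ[ℂ] τ.H)
    ((τ.preU t⁻¹).completion : τ.H →ₗ[ℂ] τ.H)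
    (by ext x; change (τ.preU t).completion ((τ.preU t⁻¹).completion x) = x
        rw [← completion_preU_mul, mul_inv_cancel, completion_preU_one])
    (by ext x; change (τ.preU t⁻¹).completion ((τ.preU t).completion x) = x
        rw [← completion_preU_mul, inv_mul_cancel, completion_preU_one])
  norm_map' x := by
    change ‖(τ.preU t).completion x‖ = ‖x‖
    induction x using Completion.induction_on with
    | hp => exact isClosed_eq (by fun_prop) (by fun_prop)
    | ih x => simp only [ContinuousLinearMap.completion_apply_coe, Completion.norm_coe, norm_preU]

theorem U_coe (t : G) (a : A) :
    τ.U t (τ.toPositive.toPreGNS a : τ.toPositive.PreGNS) =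
      ((τ.toPositive.toPreGNS (α t a) : τ.toPositive.PreGNS) : τ.H) :=
  ContinuousLinearMap.completion_apply_coe _ _

theorem U_mul (s t : G) (x : τ.H) : τ.U (s * t) x = τ.U s (τ.U t x) :=
  τ.completion_preU_mul s t x

theorem U_one (x : τ.H) : τ.U 1 x = x := τ.completion_preU_one x

theorem U_symm (t : G) (x : τ.H) : (τ.U t).symm x = τ.U t⁻¹ x := rfl

theorem conj_U_gns (t : G) (a : A) :
    (τ.U t).conjStarAlgEquiv (τ.toPositive.gnsStarAlgHom a) =
      τ.toPositive.gnsStarAlgHom (α t a) := by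
  ext x
  rw [LinearIsometryEquiv.conjStarAlgEquiv_apply_apply, U_symm]
  induction x using Completion.induction_on with
  | hp => exact isClosed_eq (by fun_prop) (by fun_prop)
  | ih x =>
    obtain ⟨b, rfl⟩ := τ.toPositive.toPreGNS.surjective x
    have h : α t (α t⁻¹ b) = b := by
      rw [← StarAlgEquiv.mul_apply, ← map_mul]; simp
    rw [U_coe, gnsStarAlgHom_coe, gnsStarAlgHom_coe, U_coe, map_mul, h]

theorem conj_U_mem (t : G) (y : τ.H →L[ℂ] τ.H)
    (hy : y ∈ (gnsVonNeumann τ.toPositive).toStarSubalgebra) :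
    (τ.U t).conjStarAlgEquiv y ∈ (gnsVonNeumann τ.toPositive).toStarSubalgebra := by
  rw [← SetLike.mem_coe, coe_gnsVonNeumann] at hy ⊢
  intro z hz
  have hc := (τ.U t).conjStarAlgEquiv.apply_symm_apply z
  have hz' : (τ.U t).conjStarAlgEquiv.symm z ∈
      Set.centralizer (Set.range τ.toPositive.gnsStarAlgHom) := by
    rintro _ ⟨a, rfl⟩
    apply (τ.U t).conjStarAlgEquiv.injective
    refine (map_mul (τ.U t).conjStarAlgEquiv _ _).trans ?_
    refine Eq.trans ?_ (map_mul (τ.U t).conjStarAlgEquiv _ _).symm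
    rw [hc, conj_U_gns]
    exact hz _ ⟨_, rfl⟩
  have := congrArg (τ.U t).conjStarAlgEquiv (hy _ hz')
  rwa [map_mul, map_mul, hc] at this

theorem conj_U_symm_mem (t : G) (y : τ.H →L[ℂ] τ.H)
    (hy : y ∈ (gnsVonNeumann τ.toPositive).toStarSubalgebra) :
    (τ.U t).conjStarAlgEquiv.symm y ∈ (gnsVonNeumann τ.toPositive).toStarSubalgebra := by
  have h : (τ.U t).conjStarAlgEquiv.symm y = (τ.U t⁻¹).conjStarAlgEquiv y := by
    ext x
    change τ.U t⁻¹ (y (τ.U t x)) = τ.U t⁻¹ (y (τ.U t⁻¹⁻¹ x))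
    rw [inv_inv]
  rw [h]
  exact τ.conj_U_mem t⁻¹ y hy

/-- The action of `G` on `M` with `t · π(a) = π(t · a)`, namely `t · y = Uₜ y Uₜ^*`. -/
noncomputable def action : G →* (τ.M ≃⋆ₐ[ℂ] τ.M) where
  toFun t :=
    restrictStarAlgEquiv (gnsVonNeumann τ.toPositive).toStarSubalgebra
      (τ.U t).conjStarAlgEquiv (τ.conj_U_mem t) (τ.conj_U_symm_mem t)
  map_one' := StarAlgEquiv.ext fun y => Subtype.ext <| ContinuousLinearMap.ext fun x => by
    change τ.U 1 (τ.incl y (τ.U 1⁻¹ x)) = τ.incl y x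
    rw [inv_one, U_one, U_one]
  map_mul' s t := StarAlgEquiv.ext fun y => Subtype.ext <| ContinuousLinearMap.ext fun x => by
    change τ.U (s * t) (τ.incl y (τ.U (s * t)⁻¹ x)) =
      τ.U s (τ.U t (τ.incl y (τ.U t⁻¹ (τ.U s⁻¹ x))))
    rw [mul_inv_rev, U_mul, U_mul]

theorem incl_action (t : G) (y : τ.M) (x : τ.H) :
    τ.incl (τ.action t y) x = τ.U t (τ.incl y ((τ.U t).symm x)) := rfl

theorem action_π (t : G) (a : A) : τ.action t (τ.π a) = τ.π (α t a) :=
  Subtype.ext (τ.conj_U_gns t a)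

end InvariantTrace

/-- A pseudoexpectation `A ⋊ᵤ G → M` for `(A, τ, G)`: a unital completely positive `G`-equivariant
map that restricts to the GNS representation `π` on `A`. -/
structure Pseudoexpectation (τ : InvariantTrace α) extends
    CompletelyPositiveMap (CrossedProduct α) τ.M where
  map_one' : toLinearMap 1 = 1
  equivariant (s : G) (b : CrossedProduct α) :
    toLinearMap (CrossedProduct.action α s b) = τ.action s (toLinearMap b)
  map_ι (a : A) : toLinearMap (CrossedProduct.ι α a) = τ.π a

noncomputable instance (τ : InvariantTrace α) :
    CoeFun (Pseudoexpectation τ) fun _ => CrossedProduct α → τ.M :=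
  ⟨fun F => F.toLinearMap⟩

/-- The families `{xₜ}` in `M` with `x_e = 1`, `xₜ y = (t · y) xₜ`, `s · xₜ = x_{s t s⁻¹}` and
with `[x_{s t⁻¹}]_{s, t ∈ F}` a positive matrix over `M` for all finite `F ⊆ G`. -/
structure TraceFamily (τ : InvariantTrace α) where
  x : G → τ.M
  one : x 1 = 1
  mul_eq (t : G) (y : τ.M) : x t * y = τ.action t y * x t
  action_eq (s t : G) : τ.action s (x t) = x (s * t * s⁻¹)
  matrix_nonneg (F : Finset G) :
    0 ≤ (CStarMatrix.ofMatrix (Matrix.of fun s t : F => x ((s : G) * (t : G)⁻¹)))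

/-- The tracial states on `A ⋊ᵤ G` that restrict to `τ` on `A`. -/
structure TracialExtension (τ : InvariantTrace α) extends TracialState (CrossedProduct α) where
  map_ι (a : A) : toPositive (CrossedProduct.ι α a) = τ.toPositive a

end TracialGNS

/-!
The three sets are compared along a cycle: pseudoexpectation, family, trace, pseudoexpectation.

*Pseudoexpectation to family.* Complete positivity of `F` on `[bᵢ^* bⱼ]` forces `A` into the
multiplicative domain of `F` (`Pseudoexpectation.map_mul_ι`), so `F(a t) = π(a) F(t)`, and `F` is
determined by `xₜ = F(t)`. From `xₜ π(a) = π(t · a) xₜ = Uₜ π(a) Uₜ^* xₜ` it follows that `Uₜ^* xₜ`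
commutes with `π(A)`, hence with `M = π(A)″`; this is `xₜ y = (t · y) xₜ` on all of `M`,
with no normality argument. The matrix `[x_{s t⁻¹}]` is the image of the Gram matrix of the
unitaries `s⁻¹`.

*Family to trace.* The functional `a t ↦ τ_M(π(a) xₜ)` on `A[G]` is positive because
`[x_{s t⁻¹}]` is (`TraceFamily.lin_nonneg`). Its GNS construction is a covariant representation, so
it is bounded for the universal norm and extends to `A ⋊ᵤ G` (`AlgPositiveFunctional.extend`). The
trace identity is checked on the elements `a t`, from the trace property and invariance of `τ_M`.

*Trace to pseudoexpectation.* If `σ` extends `τ`, then `H_τ` embeds isometrically in `H_σ`, and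
`F(b) = V^* π_σ(b) V` has matrix coefficients `⟨a, F(b) c⟩ = σ(a^* b c)`. As `σ` is a trace, `F(b)`
commutes with the right multiplications by `A` on `H_τ`, and the commutation theorem
(`InvariantTrace.mem_of_commute_R`) puts it in `M`. Then `τ_M(π(a) F(t)) = σ(a t)`.

The class `ξ` of `1` is separating for `M` (`InvariantTrace.incl_ξ_injective`), so `xₜ` is
determined by the numbers `τ_M(π(a) xₜ)`. Hence going once around the cycle returns every family and
every trace to itself; as `F` is determined by `{xₜ}`, both maps of the theorem are bijective.
-/

/-! ### Positivity of matrices over an algebra of operators -/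

section MatrixPositivity

open scoped InnerProductSpace ComplexOrder
open ContinuousLinearMap

/-- In a C*-algebra, a self-adjoint element `x` is tested for positivity by its own negative part
`y`: if `y = z^* z`, then `y x y = -y³ = -(z y)^* (z y)`, and `z y = 0` only if `y = 0`. -/
theorem IsSelfAdjoint.exists_conj_eq_neg {C : Type*} [NonUnitalCStarAlgebra C] [PartialOrder C]
    [StarOrderedRing C] {x : C} (hx : IsSelfAdjoint x) :
    ∃ y z : C, star y * x * y = -(star (z * y) * (z * y)) ∧ (z * y = 0 → 0 ≤ x) := by
  obtain ⟨z, hz⟩ := CStarAlgebra.nonneg_iff_eq_star_mul_self.mp (CFC.negPart_nonneg x)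
  have hs : star x⁻ = x⁻ := (CFC.negPart_nonneg x).isSelfAdjoint
  have h1 : star x⁻ * x = -(x⁻ * x⁻) := by
    nth_rewrite 2 [← CFC.posPart_sub_negPart x hx]
    rw [hs, mul_sub, CFC.negPart_mul_posPart, zero_sub]
  refine ⟨x⁻, z, ?_, fun h => ?_⟩
  · rw [h1, star_mul, hs, neg_mul, mul_assoc x⁻ (star z), ← mul_assoc (star z), ← hz, ← mul_assoc]
  · rw [CStarAlgebra.nonneg_iff_isSelfAdjoint_and_negPart_eq_zero]
    refine ⟨hx, (CStarRing.star_mul_self_eq_zero_iff _).mp ?_⟩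
    rw [hs]
    nth_rewrite 1 [hz]
    rw [mul_assoc, h, mul_zero]

/-- `CStarAlgebra.nonneg_iff_eq_star_mul_self` with its functional calculus instances resolved for
an abstract C*-algebra; on `CStarMatrix n n N` they are not found by instance search. -/
theorem exists_eq_star_mul_self_of_nonneg {C : Type*} [NonUnitalCStarAlgebra C] [PartialOrder C]
    [StarOrderedRing C] {x : C} (hx : 0 ≤ x) : ∃ y : C, x = star y * y :=
  CStarAlgebra.nonneg_iff_eq_star_mul_self.mp hx

variable {N : Type*} [CStarAlgebra N]
  {K : Type*} [NormedAddCommGroup K] [InnerProductSpace ℂ K] [CompleteSpace K]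
  {n : Type*} [Fintype n]

theorem inner_star_mul_map (φ : N →⋆ₐ[ℂ] (K →L[ℂ] K)) (a b : N) (h k : K) :
    ⟪h, φ (star a * b) k⟫_ℂ = ⟪φ a h, φ b k⟫_ℂ := by
  rw [map_mul, map_star, star_eq_adjoint, FunLike.coe_mul_eq_comp, Function.comp_apply,
    adjoint_inner_right]

theorem CStarMatrix.sum_inner_star_mul_self (φ : N →⋆ₐ[ℂ] (K →L[ℂ] K)) (Y : CStarMatrix n n N)
    (h : n → K) :
    ∑ i, ∑ j, ⟪h i, φ ((star Y * Y) i j) (h j)⟫_ℂ =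
      ∑ k, ⟪∑ i, φ (Y k i) (h i), ∑ j, φ (Y k j) (h j)⟫_ℂ := by
  simp only [CStarMatrix.mul_apply, CStarMatrix.star_apply, map_sum,
    FunLike.coe_sum, Finset.sum_apply, inner_sum, sum_inner, inner_star_mul_map]
  rw [Finset.sum_congr rfl fun i _ => Finset.sum_comm, Finset.sum_comm]
  exact Finset.sum_congr rfl fun k _ => Finset.sum_comm

variable [PartialOrder N] [StarOrderedRing N]

theorem CStarMatrix.sum_inner_nonneg (φ : N →⋆ₐ[ℂ] (K →L[ℂ] K)) {X : CStarMatrix n n N}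
    (hX : 0 ≤ X) (h : n → K) : 0 ≤ ∑ i, ∑ j, ⟪h i, φ (X i j) (h j)⟫_ℂ := by
  obtain ⟨Y, rfl⟩ := exists_eq_star_mul_self_of_nonneg hX
  rw [sum_inner_star_mul_self]
  refine Finset.sum_nonneg fun k _ => ?_
  rw [inner_self_eq_norm_sq_to_K]
  positivity

/-- A self-adjoint matrix over an algebra of operators on `K` is positive if it is positive as a
form on `Kⁿ`; it suffices to test it on the columns of the matrix `y` of
`IsSelfAdjoint.exists_conj_eq_neg`. -/
theorem CStarMatrix.nonneg_of_sum_inner_nonneg (φ : N →⋆ₐ[ℂ] (K →L[ℂ] K))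
    (hφ : Function.Injective φ) {X : CStarMatrix n n N} (hs : IsSelfAdjoint X)
    (hX : ∀ h : n → K, 0 ≤ ∑ i, ∑ j, ⟪h i, φ (X i j) (h j)⟫_ℂ) : 0 ≤ X := by
  obtain ⟨Y, Z, hYXY, hZY⟩ := hs.exists_conj_eq_neg
  refine hZY ?_
  ext l k
  refine hφ ?_
  rw [CStarMatrix.zero_apply, map_zero]
  ext h
  have h1 := hX fun i => φ (Y i k) h
  have h2 : ∑ i, ∑ j, ⟪φ (Y i k) h, φ (X i j) (φ (Y j k) h)⟫_ℂ =
      ⟪h, φ ((star Y * X * Y) k k) h⟫_ℂ := by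
    simp only [CStarMatrix.mul_apply, CStarMatrix.star_apply, Finset.sum_mul, map_sum,
      FunLike.coe_sum, Finset.sum_apply, inner_sum, mul_assoc, inner_star_mul_map]
    rw [Finset.sum_comm]
    simp [map_mul]
  have h3 : ⟪h, φ ((star (Z * Y) * (Z * Y)) k k) h⟫_ℂ =
      ∑ l, (‖φ ((Z * Y) l k) h‖ ^ 2 : ℂ) := by
    rw [CStarMatrix.mul_apply]
    simp only [CStarMatrix.star_apply, map_sum, FunLike.coe_sum, Finset.sum_apply, inner_sum,
      inner_star_mul_map, inner_self_eq_norm_sq_to_K]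
    rfl
  rw [h2, hYXY, CStarMatrix.neg_apply, map_neg, _root_.neg_apply, inner_neg_right, h3,
    Left.nonneg_neg_iff] at h1
  have h4 : ∑ l, ‖φ ((Z * Y) l k) h‖ ^ 2 ≤ 0 := by exact_mod_cast h1
  have h5 := (Finset.sum_eq_zero_iff_of_nonneg (fun l _ => by positivity)).mp
    (le_antisymm h4 (Finset.sum_nonneg fun l _ => by positivity)) l (Finset.mem_univ l)
  simpa using h5

end MatrixPositivity

/-! ### The trace vector and the commutation theorem -/

section TraceVector

open UniformSpace ContinuousLinearMap
open scoped InnerProductSpace ComplexOrder ComplexConjugate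

variable {A : Type u} {G : Type v} [CStarAlgebra A] [PartialOrder A] [StarOrderedRing A] [Group G]
  {α : G →* (A ≃⋆ₐ[ℂ] A)}

theorem commute_apply {K : Type*} [NormedAddCommGroup K] [InnerProductSpace ℂ K] {S T : K →L[ℂ] K}
    (h : Commute S T) (x : K) : S (T x) = T (S x) :=
  congrArg (fun Q : K →L[ℂ] K => Q x) h.eq

theorem gns_inner_coe (f : A →ₚ[ℂ] ℂ) (a b : A) :
    ⟪((f.toPreGNS a : f.PreGNS) : f.GNS), ((f.toPreGNS b : f.PreGNS) : f.GNS)⟫_ℂ =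
      f (star a * b) := by
  rw [Completion.inner_coe, PositiveLinearMap.preGNS_inner_def]
  simp

namespace InvariantTrace

variable (τ : InvariantTrace α)

/-- The class in `H_τ` of an element of `A`. -/
noncomputable def vec (a : A) : τ.H := ((τ.toPositive.toPreGNS a : τ.toPositive.PreGNS) : τ.H)

theorem incl_mul_apply (x y : τ.M) (v : τ.H) : τ.incl (x * y) v = τ.incl x (τ.incl y v) := rfl

theorem ξ_eq : τ.ξ = τ.vec 1 := rfl

theorem inner_vec (a b : A) : ⟪τ.vec a, τ.vec b⟫_ℂ = τ.toPositive (star a * b) :=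
  gns_inner_coe _ a b

variable {τ} in
theorem vec_induction {p : τ.H → Prop} (x : τ.H) (hc : IsClosed {x | p x})
    (h : ∀ a : A, p (τ.vec a)) : p x :=
  Completion.induction_on x hc h

variable {τ} in
theorem ext_inner_vec {x y : τ.H} (h : ∀ a, ⟪τ.vec a, x⟫_ℂ = ⟪τ.vec a, y⟫_ℂ) : x = y :=
  ext_inner_left ℂ fun v => by
    induction v using vec_induction with
    | hc => exact isClosed_eq (by fun_prop) (by fun_prop)
    | h a => exact h a

variable {τ} in
theorem operator_ext {S T : τ.H →L[ℂ] τ.H}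
    (h : ∀ a b, ⟪τ.vec a, S (τ.vec b)⟫_ℂ = ⟪τ.vec a, T (τ.vec b)⟫_ℂ) : S = T := by
  ext x
  induction x using vec_induction with
  | hc => exact isClosed_eq (by fun_prop) (by fun_prop)
  | h b => exact ext_inner_vec fun a => h a b

/-- The GNS representation as bounded operators on `H_τ`. -/
noncomputable abbrev gns (a : A) : τ.H →L[ℂ] τ.H := τ.toPositive.gnsStarAlgHom a

theorem gns_vec (a b : A) : τ.gns a (τ.vec b) = τ.vec (a * b) := gnsStarAlgHom_coe _ a b

theorem gns_ξ (a : A) : τ.gns a τ.ξ = τ.vec a := by rw [ξ_eq, gns_vec, mul_one]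

theorem inner_gns (a : A) (x y : τ.H) : ⟪τ.gns a x, y⟫_ℂ = ⟪x, τ.gns (star a) y⟫_ℂ := by
  rw [gns, gns, map_star, star_eq_adjoint, adjoint_inner_right]

/-- The conjugate-linear isometry `a ↦ a^*` of the pre-Hilbert space `A`. -/
noncomputable def preJ : τ.toPositive.PreGNS →ₗᵢ⋆[ℂ] τ.toPositive.PreGNS where
  toFun x := τ.toPositive.toPreGNS (star (τ.toPositive.ofPreGNS x))
  map_add' x y := by simp
  map_smul' c x := by simp
  norm_map' x := by
    simp only [PositiveLinearMap.preGNS_norm_def, LinearMap.coe_mk, AddHom.coe_mk,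
      PositiveLinearMap.ofPreGNS_toPreGNS, star_star]
    rw [τ.map_mul_comm']

/-- The modular conjugation of the trace vector `ξ`: the conjugate-linear isometric involution of
`H_τ` that maps the class of `a` to that of `a^*`. -/
noncomputable def J : τ.H →L⋆[ℂ] τ.H := τ.preJ.toContinuousLinearMap.completion

theorem J_vec (a : A) : τ.J (τ.vec a) = τ.vec (star a) :=
  ContinuousLinearMap.completion_apply_coe _ _

theorem J_J (x : τ.H) : τ.J (τ.J x) = x := by
  induction x using vec_induction with
  | hc => exact isClosed_eq (by fun_prop) (by fun_prop)
  | h a => rw [J_vec, J_vec, star_star]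

theorem inner_J_J (x y : τ.H) : ⟪τ.J x, τ.J y⟫_ℂ = ⟪y, x⟫_ℂ := by
  induction x using vec_induction with
  | hc => exact isClosed_eq (by fun_prop) (by fun_prop)
  | h a =>
    induction y using vec_induction with
    | hc => exact isClosed_eq (by fun_prop) (by fun_prop)
    | h b => rw [J_vec, J_vec, inner_vec, inner_vec, star_star, τ.map_mul_comm']

theorem inner_J_left (x y : τ.H) : ⟪τ.J x, y⟫_ℂ = ⟪τ.J y, x⟫_ℂ := by
  rw [← inner_J_J, J_J]

theorem inner_J_right (x y : τ.H) : ⟪x, τ.J y⟫_ℂ = ⟪y, τ.J x⟫_ℂ := by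
  rw [← inner_J_J, J_J]

/-- The operator `J π(c) J` of right multiplication by `c^*`. -/
noncomputable def R (c : A) : τ.H →L[ℂ] τ.H := (τ.J.comp (τ.gns c)).comp τ.J

theorem R_apply (c : A) (x : τ.H) : τ.R c x = τ.J (τ.gns c (τ.J x)) := rfl

theorem R_vec (c b : A) : τ.R c (τ.vec b) = τ.vec (b * star c) := by
  rw [R_apply, J_vec, gns_vec, J_vec, star_mul, star_star]

theorem R_ξ (c : A) : τ.R c τ.ξ = τ.vec (star c) := by rw [ξ_eq, R_vec, one_mul]

theorem inner_R (c : A) (x y : τ.H) : ⟪τ.R c x, y⟫_ℂ = ⟪x, τ.R (star c) y⟫_ℂ := by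
  rw [R_apply, R_apply, inner_J_left, inner_J_right _ x, inner_gns, star_star]

theorem star_R (c : A) : star (τ.R c) = τ.R (star c) :=
  ((eq_adjoint_iff _ _).mpr fun x y => by rw [inner_R, star_star]).symm

theorem commute_gns_R (a c : A) : Commute (τ.gns a) (τ.R c) := by
  change τ.gns a * τ.R c = τ.R c * τ.gns a
  ext x
  change τ.gns a (τ.R c x) = τ.R c (τ.gns a x)
  induction x using vec_induction with
  | hc => exact isClosed_eq (by fun_prop) (by fun_prop)
  | h b => rw [R_vec, gns_vec, gns_vec, R_vec, mul_assoc]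

variable {τ}

/-- For `T` in the commutant of the left multiplications, `J (T ξ) = T^* ξ`. -/
theorem J_apply_ξ_of_commute_gns {T : τ.H →L[ℂ] τ.H} (h : ∀ a, Commute (τ.gns a) T) :
    τ.J (T τ.ξ) = star T τ.ξ := by
  refine ext_inner_vec fun c => ?_
  rw [star_eq_adjoint, adjoint_inner_right, inner_J_right, J_vec, ← gns_ξ τ c]
  have h1 : T (τ.gns c τ.ξ) = τ.gns c (T τ.ξ) := (commute_apply (h c) τ.ξ).symm
  rw [h1, inner_gns, gns_ξ]

/-- For `T` in the commutant of the right multiplications, `J (T ξ) = T^* ξ`. -/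
theorem J_apply_ξ_of_commute_R {T : τ.H →L[ℂ] τ.H} (h : ∀ a, Commute (τ.R a) T) :
    τ.J (T τ.ξ) = star T τ.ξ := by
  refine ext_inner_vec fun c => ?_
  rw [star_eq_adjoint, adjoint_inner_right]
  have h0 : τ.vec c = τ.R (star c) τ.ξ := by rw [R_ξ, star_star]
  have h1 : T (τ.R (star c) τ.ξ) = τ.R (star c) (T τ.ξ) := (commute_apply (h _) τ.ξ).symm
  rw [inner_J_right, J_vec, h0, h1, inner_R, star_star, R_ξ]

theorem commute_adjoint_of_commute_R {T : τ.H →L[ℂ] τ.H} (h : ∀ a, Commute (τ.R a) T) (a : A) :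
    Commute (τ.R a) (star T) := by
  have := (h (star a)).star_star
  rwa [star_R, star_star] at this

/-- The commutation theorem for the trace: the operators that commute with all right
multiplications lie in `π(A)″`. For `S` in the commutant of `π(A)`, both `⟨a, S T b⟩` and
`⟨a, T S b⟩` reduce to `⟨T^* ξ, R(a) π(b) S ξ⟩`. -/
theorem mem_of_commute_R {T : τ.H →L[ℂ] τ.H} (h : ∀ a, Commute (τ.R a) T) :
    T ∈ (gnsVonNeumann τ.toPositive).toStarSubalgebra := by
  rw [← SetLike.mem_coe, coe_gnsVonNeumann]
  intro S hS
  have hS' : ∀ a, Commute (τ.gns a) S := fun a => hS _ ⟨a, rfl⟩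
  refine operator_ext fun a b => ?_
  change ⟪τ.vec a, S (T (τ.vec b))⟫_ℂ = ⟪τ.vec a, T (S (τ.vec b))⟫_ℂ
  have hT := commute_adjoint_of_commute_R h
  have h1 : S (τ.vec b) = τ.gns b (S τ.ξ) := by
    rw [← gns_ξ]; exact (commute_apply (hS' b) τ.ξ).symm
  have h2 : (star S) (τ.vec a) = τ.gns a (τ.J (S τ.ξ)) := by
    rw [J_apply_ξ_of_commute_gns hS', ← gns_ξ]
    have := (hS' (star a)).star_star
    rw [← map_star, star_star] at this
    exact (commute_apply this τ.ξ).symm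
  have h3 : T (τ.vec b) = τ.R (star b) (τ.J ((star T) τ.ξ)) := by
    rw [← J_apply_ξ_of_commute_R h, J_J, ← star_star b, ← R_ξ, star_star]
    exact (commute_apply (h _) τ.ξ).symm
  have h4 : (star T) (τ.vec a) = τ.R (star a) ((star T) τ.ξ) := by
    rw [← star_star a, ← R_ξ, star_star]
    exact (commute_apply (hT _) τ.ξ).symm
  rw [← adjoint_inner_left, ← star_eq_adjoint, h2, h3, ← adjoint_inner_left T, ← star_eq_adjoint,
    h1, h4, R_apply, J_J, inner_J_right,
    inner_gns, star_star, inner_R, star_star]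
  exact congrArg _ (commute_apply (commute_gns_R τ b a) (S τ.ξ))

theorem incl_mem (y : τ.M) : τ.incl y ∈ (gnsVonNeumann τ.toPositive).toStarSubalgebra := y.2

theorem incl_injective : Function.Injective τ.incl := Subtype.val_injective

theorem commute_incl_of_commute_gns {T : τ.H →L[ℂ] τ.H} (h : ∀ a, Commute (τ.gns a) T)
    (y : τ.M) : Commute T (τ.incl y) := by
  have hy := τ.incl_mem y
  rw [← SetLike.mem_coe, coe_gnsVonNeumann] at hy
  refine hy T ?_
  rintro _ ⟨a, rfl⟩
  exact h a

theorem commute_R_incl (c : A) (y : τ.M) : Commute (τ.R c) (τ.incl y) :=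
  commute_incl_of_commute_gns (fun a => τ.commute_gns_R a c) y

/-- The trace vector is separating for `M`. -/
theorem incl_ξ_injective : Function.Injective fun y : τ.M => τ.incl y τ.ξ := by
  intro y z h
  refine incl_injective (ContinuousLinearMap.ext fun x => ?_)
  induction x using vec_induction with
  | hc => exact isClosed_eq (by fun_prop) (by fun_prop)
  | h a =>
    rw [← star_star a, ← R_ξ]
    have h1 : τ.incl y (τ.R (star a) τ.ξ) = τ.R (star a) (τ.incl y τ.ξ) :=
      (commute_apply (commute_R_incl (star a) y) τ.ξ).symm
    have h2 : τ.incl z (τ.R (star a) τ.ξ) = τ.R (star a) (τ.incl z τ.ξ) :=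
      (commute_apply (commute_R_incl (star a) z) τ.ξ).symm
    rw [h1, h2]
    exact congrArg _ h

theorem J_incl_ξ (y : τ.M) : τ.J (τ.incl y τ.ξ) = τ.incl (star y) τ.ξ := by
  rw [J_apply_ξ_of_commute_R fun a => commute_R_incl a y, map_star]

theorem traceM_star_mul (x y : τ.M) :
    τ.traceM (star x * y) = ⟪τ.incl x τ.ξ, τ.incl y τ.ξ⟫_ℂ := inner_star_mul_map τ.incl x y _ _

theorem traceM_mul_comm (x y : τ.M) : τ.traceM (x * y) = τ.traceM (y * x) := by
  rw [← star_star x, traceM_star_mul, ← star_star y, ← J_incl_ξ, ← J_incl_ξ, inner_J_J,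
    ← traceM_star_mul, star_star, star_star]

theorem traceM_star (x : τ.M) : τ.traceM (star x) = conj (τ.traceM x) := by
  rw [traceM, traceM, map_star, star_eq_adjoint, adjoint_inner_right, inner_conj_symm]

theorem traceM_π_mul (a : A) (x : τ.M) :
    τ.traceM (τ.π a * x) = ⟪τ.vec (star a), τ.incl x τ.ξ⟫_ℂ := by
  rw [← star_star a, map_star, traceM_star_mul, incl_π, star_star]
  exact congr(⟪$(τ.gns_ξ (star a)), _⟫_ℂ)

theorem eq_of_traceM_π_mul {x y : τ.M} (h : ∀ a, τ.traceM (τ.π a * x) = τ.traceM (τ.π a * y)) :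
    x = y :=
  incl_ξ_injective <| ext_inner_vec fun a => by
    simpa only [traceM_π_mul, star_star] using h (star a)

theorem U_vec (t : G) (a : A) : τ.U t (τ.vec a) = τ.vec (α t a) := τ.U_coe t a

theorem U_ξ (t : G) : τ.U t τ.ξ = τ.ξ := by rw [ξ_eq, U_vec, map_one]

theorem traceM_action (t : G) (y : τ.M) : τ.traceM (τ.action t y) = τ.traceM y := by
  rw [traceM, traceM, incl_action, U_symm, U_ξ]
  nth_rewrite 1 [← τ.U_ξ t]
  exact (τ.U t).inner_map_map _ _

end InvariantTrace
end TraceVector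

/-! ### From pseudoexpectations to families -/

section CrossedProductLemmas

variable {A : Type u} {G : Type v} [CStarAlgebra A] [Group G] {α : G →* (A ≃⋆ₐ[ℂ] A)}

namespace CrossedProduct

/-- A closed additive condition on `A ⋊ᵤ G` need only be checked on the elements `a t`. -/
theorem induction_ι_mul_u {p : CrossedProduct α → Prop} (x : CrossedProduct α)
    (hc : IsClosed {x | p x}) (ha : ∀ x y, p x → p y → p (x + y))
    (h : ∀ (a : A) (t : G), p (ι α a * u α t)) : p x := by
  induction x using induction with
  | hc => exact hc
  | h x =>
    induction x using AlgCrossedProduct.induction with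
    | hz =>
      have := h 0 1
      rwa [map_zero, zero_mul] at this
    | hs t a => rw [← ι_mul_u]; exact h a t
    | ha x y hx hy => rw [map_add]; exact ha _ _ hx hy

theorem u_mul_ι (t : G) (a : A) :
    (u α t : CrossedProduct α) * ι α a = ι α (α t a) * (u α t : CrossedProduct α) := by
  rw [ι_mul_u]
  change ofAlg α _ * ofAlg α _ = _
  rw [← map_mul, AlgCrossedProduct.single_mul_single, one_mul, mul_one]

theorem star_u (t : G) : star (u α t : CrossedProduct α) = (u α t⁻¹ : CrossedProduct α) := by
  rw [map_inv]; rfl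

theorem u_mul_u (s t : G) :
    (u α s : CrossedProduct α) * (u α t : CrossedProduct α) = (u α (s * t) : CrossedProduct α) := by
  rw [map_mul]; rfl

theorem u_one : (u α 1 : CrossedProduct α) = 1 := by rw [map_one]; rfl

theorem action_u (s t : G) :
    action α s (u α t : CrossedProduct α) = (u α (s * t * s⁻¹) : CrossedProduct α) := by
  have := action_ι_mul_u α s 1 t
  rwa [map_one, map_one, map_one, one_mul, one_mul] at this

end CrossedProduct

end CrossedProductLemmas

section PseudoexpectationToFamily

open scoped InnerProductSpace ComplexOrder
open ContinuousLinearMap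

/-- The Gram matrix `[bᵢ^* bⱼ]` is positive. -/
theorem CStarMatrix.gram_nonneg {B : Type*} [CStarAlgebra B] [PartialOrder B] [StarOrderedRing B]
    {n : Type*} [Fintype n] (b : n → B) :
    0 ≤ CStarMatrix.ofMatrix (Matrix.of fun i j => star (b i) * b j) := by
  classical
  cases isEmpty_or_nonempty n with
  | inl h => exact le_of_eq (by ext i; exact h.elim i)
  | inr h =>
    obtain ⟨k⟩ := h
    let Y : CStarMatrix n n B :=
      CStarMatrix.ofMatrix (Matrix.of fun i j => if i = k then b j else 0)
    convert star_mul_self_nonneg Y using 1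
    ext i j
    rw [CStarMatrix.mul_apply]
    simp [CStarMatrix.star_apply, Y]

variable {A : Type u} {G : Type v} [CStarAlgebra A] [PartialOrder A] [StarOrderedRing A] [Group G]
  {α : G →* (A ≃⋆ₐ[ℂ] A)} {τ : InvariantTrace α}

namespace Pseudoexpectation

variable (F : Pseudoexpectation τ)

theorem continuous : Continuous F := map_continuous F.toCompletelyPositiveMap

theorem map_star_eq (b : CrossedProduct α) : F (star b) = star (F b) :=
  map_star F.toCompletelyPositiveMap b

theorem gram_nonneg {n : Type*} [Fintype n] (b : n → CrossedProduct α) :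
    0 ≤ CStarMatrix.ofMatrix (Matrix.of fun i j => F (star (b i) * b j)) :=
  F.toCompletelyPositiveMap.map_cstarMatrix_nonneg _ (CStarMatrix.gram_nonneg b)

/-- `A` lies in the multiplicative domain of a pseudoexpectation. -/
theorem map_mul_ι (c : CrossedProduct α) (a : A) :
    F (c * CrossedProduct.ι α a) = F c * τ.π a := by
  obtain ⟨c, rfl⟩ := star_involutive.surjective c
  refine InvariantTrace.incl_injective (ContinuousLinearMap.ext fun k => sub_eq_zero.mp ?_)
  rw [map_mul τ.incl]
  change τ.incl (F (star c * CrossedProduct.ι α a)) k - τ.incl (F (star c)) (τ.incl (τ.π a) k) = 0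
  set v := τ.incl (F (star c * CrossedProduct.ι α a)) k -
    τ.incl (F (star c)) (τ.incl (τ.π a) k) with hv
  have hadj (x : τ.M) (y z : τ.H) : ⟪y, τ.incl x z⟫_ℂ = ⟪τ.incl (star x) y, z⟫_ℂ := by
    rw [map_star, star_eq_adjoint, adjoint_inner_left]
  -- `(k, -π(a) k)` is a null vector of the positive form given by `F` on `(a, 1)`,
  -- so it is orthogonal to every vector placed at `c`; here the vector `r v`.
  have key (r : ℝ) : 0 ≤ 2 * r * ‖v‖ ^ 2 + r ^ 2 * (⟪v, τ.incl (F (star c * c)) v⟫_ℂ).re := by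
    have h := CStarMatrix.sum_inner_nonneg τ.incl
      (F.gram_nonneg ![CrossedProduct.ι α a, 1, c]) ![k, -τ.incl (τ.π a) k, (r : ℂ) • v]
    have h1 : ⟪k, τ.incl (F (star (CrossedProduct.ι α a) * c)) v⟫_ℂ -
        ⟪τ.incl (τ.π a) k, τ.incl (F c) v⟫_ℂ = (‖v‖ ^ 2 : ℂ) := by
      rw [hadj, hadj, ← F.map_star_eq, ← F.map_star_eq, star_mul, star_star, ← inner_sub_left,
        ← hv, inner_self_eq_norm_sq_to_K]
      rfl
    have h2 : ⟪v, τ.incl (F (star c * CrossedProduct.ι α a)) k⟫_ℂ -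
        ⟪v, τ.incl (F (star c)) (τ.incl (τ.π a) k)⟫_ℂ = (‖v‖ ^ 2 : ℂ) := by
      rw [← inner_sub_right, ← hv, inner_self_eq_norm_sq_to_K]
      rfl
    have h3 : ⟪k, τ.incl (τ.π (star a)) (τ.incl (τ.π a) k)⟫_ℂ =
        ⟪τ.incl (τ.π a) k, τ.incl (τ.π a) k⟫_ℂ := by
      rw [hadj, ← map_star τ.π, star_star]
    simp only [Fin.sum_univ_three, CStarMatrix.ofMatrix_apply, Matrix.of_apply,
      Matrix.cons_val_zero, Matrix.cons_val_one, Matrix.cons_val] at h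
    have h4 : star (CrossedProduct.ι α a) * CrossedProduct.ι α a =
        CrossedProduct.ι α (star a * a) := by rw [map_mul, map_star]
    have h5 : F (star (CrossedProduct.ι α a)) = τ.π (star a) := by rw [← map_star, F.map_ι]
    have h7 (z : τ.H) : τ.incl 1 z = z := rfl
    simp only [star_one, one_mul, mul_one, h4, h5, F.map_ι, F.map_one', map_neg, map_smul,
      map_mul τ.π, τ.incl_mul_apply, h7, h3, inner_neg_left, inner_neg_right, inner_smul_left,
      inner_smul_right, Complex.conj_ofReal] at h
    have h8 := (Complex.le_def.mp (h.trans_eq (b := _)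
      (c := 2 * r * (‖v‖ ^ 2 : ℂ) + r ^ 2 * ⟪v, τ.incl (F (star c * c)) v⟫_ℂ)
      (by linear_combination r * h1 + r * h2))).1
    have h9 : (2 * r * (‖v‖ ^ 2 : ℂ) + r ^ 2 * ⟪v, τ.incl (F (star c * c)) v⟫_ℂ).re =
        2 * r * ‖v‖ ^ 2 + r ^ 2 * (⟪v, τ.incl (F (star c * c)) v⟫_ℂ).re := by
      rw [Complex.add_re, ← Complex.ofReal_pow, ← Complex.ofReal_pow, Complex.re_ofReal_mul]
      norm_cast
    rwa [h9] at h8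
  -- `r = -‖v‖² / (|q| + 1)` makes the quadratic polynomial negative unless `v = 0`
  set q := (⟪v, τ.incl (F (star c * c)) v⟫_ℂ).re
  have hD : 0 < |q| + 1 := by positivity
  have h1 := key (-‖v‖ ^ 2 / (|q| + 1))
  have h2 : (-‖v‖ ^ 2 / (|q| + 1)) ^ 2 * q ≤ (-‖v‖ ^ 2 / (|q| + 1)) ^ 2 * (|q| + 1) :=
    mul_le_mul_of_nonneg_left ((le_abs_self q).trans (by linarith)) (sq_nonneg _)
  have h3 : 2 * (-‖v‖ ^ 2 / (|q| + 1)) * ‖v‖ ^ 2 + (-‖v‖ ^ 2 / (|q| + 1)) ^ 2 * (|q| + 1) =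
      -((‖v‖ ^ 2) ^ 2 / (|q| + 1)) := by
    field_simp
    ring
  have h4 : (‖v‖ ^ 2) ^ 2 / (|q| + 1) = 0 := le_antisymm (by linarith) (by positivity)
  simpa [hD.ne'] using h4

theorem map_ι_mul (a : A) (c : CrossedProduct α) :
    F (CrossedProduct.ι α a * c) = τ.π a * F c := by
  have h := F.map_mul_ι (star c) (star a)
  rw [map_star, ← star_mul, F.map_star_eq, F.map_star_eq, map_star, ← star_mul] at h
  exact star_injective h

variable {F} in
theorem ext_u {F' : Pseudoexpectation τ}
    (h : ∀ t, F (CrossedProduct.u α t) = F' (CrossedProduct.u α t)) : F = F' := by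
  have h1 : F.toLinearMap = F'.toLinearMap := by
    ext x
    induction x using CrossedProduct.induction_ι_mul_u with
    | hc => exact isClosed_eq F.continuous F'.continuous
    | ha x y hx hy => rw [map_add, map_add, hx, hy]
    | h a t => rw [map_ι_mul, map_ι_mul, h]
  cases F with | mk F _ _ _ =>
  cases F' with | mk F' _ _ _ =>
  cases F; cases F'
  congr

/-- The family `xₜ = F(t)` of a pseudoexpectation `F`. -/
noncomputable def toFamily : TraceFamily τ where
  x t := F (CrossedProduct.u α t)
  one := by rw [CrossedProduct.u_one]; exact F.map_one'
  mul_eq t y := by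
    set x := F (CrossedProduct.u α t) with hx
    have h1 (a : A) : x * τ.π a = τ.action t (τ.π a) * x := by
      rw [hx, ← F.map_mul_ι, CrossedProduct.u_mul_ι, F.map_ι_mul, τ.action_π]
    -- `Uₜ^* xₜ` commutes with `π(A)`, hence with `M`
    have h2 (a : A) : Commute (τ.gns a)
        (((τ.U t).symm : τ.H →L[ℂ] τ.H) ∘L τ.incl x) := by
      change _ * _ = _ * _
      ext v
      change τ.incl (τ.π a) ((τ.U t).symm (τ.incl x v)) = (τ.U t).symm (τ.incl (x * τ.π a) v)
      rw [h1, τ.incl_mul_apply, τ.incl_action, LinearIsometryEquiv.symm_apply_apply]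
    refine InvariantTrace.incl_injective (ContinuousLinearMap.ext fun v => ?_)
    have h3 := commute_apply (InvariantTrace.commute_incl_of_commute_gns h2 y) v
    change (τ.U t).symm (τ.incl x (τ.incl y v)) = τ.incl y ((τ.U t).symm (τ.incl x v)) at h3
    rw [τ.incl_mul_apply, τ.incl_mul_apply, τ.incl_action, ← h3,
      LinearIsometryEquiv.apply_symm_apply]
  action_eq s t := by rw [← F.equivariant, CrossedProduct.action_u]
  matrix_nonneg E := by
    have h := F.gram_nonneg fun s : E => (CrossedProduct.u α (s : G)⁻¹ : CrossedProduct α)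
    simpa only [CrossedProduct.star_u, CrossedProduct.u_mul_u, inv_inv] using h

end Pseudoexpectation
end PseudoexpectationToFamily

/-! ### Positive functionals on the algebraic crossed product -/

section AlgebraicGNS

open UniformSpace
open scoped InnerProductSpace ComplexOrder ComplexConjugate

variable {A : Type u} {G : Type v} [CStarAlgebra A] [Group G] {α : G →* (A ≃⋆ₐ[ℂ] A)}

variable (α) in
/-- A positive linear functional on the *-algebra `A[G]`. No continuity is required. -/
structure AlgPositiveFunctional where
  /-- the underlying linear functional -/
  toLin : AlgCrossedProduct α →ₗ[ℂ] ℂ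
  map_star' (z : AlgCrossedProduct α) : toLin (star z) = conj (toLin z)
  nonneg' (z : AlgCrossedProduct α) : 0 ≤ toLin (star z * z)

namespace AlgPositiveFunctional

variable (φ : AlgPositiveFunctional α)

set_option linter.unusedVariables false in
/-- The pre-Hilbert space `(A[G], ⟨z, w⟩ = φ(z^* w))`, a type synonym of `A[G]`. -/
def PreGNS (φ : AlgPositiveFunctional α) : Type (max u v) := AlgCrossedProduct α

noncomputable instance : AddCommGroup φ.PreGNS :=
  inferInstanceAs (AddCommGroup (AlgCrossedProduct α))
noncomputable instance : Module ℂ φ.PreGNS := inferInstanceAs (Module ℂ (AlgCrossedProduct α))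

/-- The identity map from `A[G]` to the pre-Hilbert space of `φ`. -/
noncomputable def toPre : AlgCrossedProduct α ≃ₗ[ℂ] φ.PreGNS := LinearEquiv.refl ℂ _

/-- The semi-inner product `⟨z, w⟩ = φ(z^* w)`. -/
noncomputable abbrev core : PreInnerProductSpace.Core ℂ φ.PreGNS where
  inner z w := φ.toLin (star (φ.toPre.symm z) * φ.toPre.symm w)
  conj_inner_symm z w := by rw [← φ.map_star', star_mul, star_star]
  re_inner_nonneg z := (Complex.le_def.mp (φ.nonneg' _)).1
  add_left x y z := by rw [map_add, star_add, add_mul, map_add]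
  smul_left x y c := by
    rw [map_smul, star_smul, smul_mul_assoc, map_smul]
    rfl

noncomputable instance : SeminormedAddCommGroup φ.PreGNS :=
  InnerProductSpace.Core.toSeminormedAddCommGroup (c := φ.core)
noncomputable instance : InnerProductSpace ℂ φ.PreGNS := InnerProductSpace.ofCore φ.core

theorem inner_toPre (z w : AlgCrossedProduct α) :
    ⟪φ.toPre z, φ.toPre w⟫_ℂ = φ.toLin (star z * w) := rfl

theorem norm_sq_toPre (z : AlgCrossedProduct α) :
    ‖φ.toPre z‖ ^ 2 = (φ.toLin (star z * z)).re := by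
  rw [← inner_toPre, ← inner_self_eq_norm_sq (𝕜 := ℂ)]; rfl

/-- The GNS Hilbert space of `φ`. -/
abbrev GNS : Type (max u v) := Completion φ.PreGNS

/-- The class in the GNS Hilbert space of an element of `A[G]`. -/
noncomputable def vec (z : AlgCrossedProduct α) : φ.GNS := (φ.toPre z : φ.GNS)

variable {φ} in
theorem vec_induction {p : φ.GNS → Prop} (x : φ.GNS) (hc : IsClosed {x | p x})
    (h : ∀ z, p (φ.vec z)) : p x :=
  Completion.induction_on x hc h

theorem inner_vec (z w : AlgCrossedProduct α) : ⟪φ.vec z, φ.vec w⟫_ℂ = φ.toLin (star z * w) :=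
  Completion.inner_coe _ _

theorem vec_add (z w : AlgCrossedProduct α) : φ.vec (z + w) = φ.vec z + φ.vec w :=
  Completion.coe_add _ _

theorem vec_smul (c : ℂ) (z : AlgCrossedProduct α) : φ.vec (c • z) = c • φ.vec z :=
  Completion.coe_smul c (φ.toPre z)

variable {φ} in
theorem operator_ext {S T : φ.GNS →L[ℂ] φ.GNS} (h : ∀ z, S (φ.vec z) = T (φ.vec z)) : S = T := by
  ext x
  induction x using vec_induction with
  | hc => exact isClosed_eq (by fun_prop) (by fun_prop)
  | h z => exact h z

theorem norm_single_mul (t : G) (z : AlgCrossedProduct α) :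
    ‖φ.toPre (AlgCrossedProduct.single α t 1 * z)‖ = ‖φ.toPre z‖ := by
  rw [← sq_eq_sq₀ (norm_nonneg _) (norm_nonneg _), norm_sq_toPre, norm_sq_toPre, star_mul,
    AlgCrossedProduct.star_single, mul_assoc, ← mul_assoc _ _ z,
    AlgCrossedProduct.single_mul_single]
  simp [← AlgCrossedProduct.one_def]

variable [PartialOrder A] [StarOrderedRing A]

theorem norm_single_one_mul_le (a : A) (z : AlgCrossedProduct α) :
    ‖φ.toPre (AlgCrossedProduct.single α 1 a * z)‖ ≤ ‖a‖ * ‖φ.toPre z‖ := by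
  -- `‖a‖² - a^* a = c^* c` in `A`, so the difference of the squares is `‖c z‖²`
  have h : 0 ≤ algebraMap ℝ A (‖a‖ ^ 2) - star a * a :=
    sub_nonneg.mpr CStarAlgebra.star_mul_le_algebraMap_norm_sq
  obtain ⟨c, hc⟩ := exists_eq_star_mul_self_of_nonneg h
  have h1 (d : A) : star (AlgCrossedProduct.single α 1 d * z) * (AlgCrossedProduct.single α 1 d * z)
      = star z * (AlgCrossedProduct.single α 1 (star d * d) * z) := by
    rw [star_mul, AlgCrossedProduct.star_single, mul_assoc, ← mul_assoc _ _ z,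
      AlgCrossedProduct.single_mul_single]
    simp
  have h2 : ‖φ.toPre (AlgCrossedProduct.single α 1 c * z)‖ ^ 2 =
      ‖a‖ ^ 2 * ‖φ.toPre z‖ ^ 2 - ‖φ.toPre (AlgCrossedProduct.single α 1 a * z)‖ ^ 2 := by
    rw [norm_sq_toPre, norm_sq_toPre, norm_sq_toPre, h1, h1, ← hc, sub_eq_add_neg,
      AlgCrossedProduct.single_add, add_mul, mul_add, map_add, Complex.add_re, sub_eq_add_neg]
    congr 1
    · rw [Algebra.algebraMap_eq_smul_one, ← Complex.coe_smul, ← AlgCrossedProduct.smul_single,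
        ← AlgCrossedProduct.one_def, smul_mul_assoc, one_mul, mul_smul_comm, map_smul, smul_eq_mul,
        Complex.re_ofReal_mul]
    · rw [← neg_one_smul ℂ (star a * a), ← AlgCrossedProduct.smul_single, smul_mul_assoc,
        mul_smul_comm, map_smul]
      simp
  refine le_of_sq_le_sq ?_ (by positivity)
  rw [mul_pow]
  nlinarith [sq_nonneg ‖φ.toPre (AlgCrossedProduct.single α 1 c * z)‖]

/-- Left multiplications on the pre-Hilbert space are bounded, although `φ` is not assumed
continuous: this holds for the elements of `A` and for the unitaries `t`, which generate `A[G]`. -/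
theorem exists_norm_mul_le (w : AlgCrossedProduct α) :
    ∃ C : ℝ, ∀ z, ‖φ.toPre (w * z)‖ ≤ C * ‖φ.toPre z‖ := by
  induction w using AlgCrossedProduct.induction with
  | hz => exact ⟨0, fun z => by simp⟩
  | hs t a =>
    refine ⟨‖a‖, fun z => ?_⟩
    have h : AlgCrossedProduct.single α t a =
        AlgCrossedProduct.single α 1 a * AlgCrossedProduct.single α t 1 := by
      rw [AlgCrossedProduct.single_mul_single]; simp
    rw [h, mul_assoc, ← φ.norm_single_mul t z]
    exact φ.norm_single_one_mul_le a _
  | ha x y hx hy =>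
    obtain ⟨C, hC⟩ := hx
    obtain ⟨D, hD⟩ := hy
    refine ⟨C + D, fun z => ?_⟩
    rw [add_mul, map_add, add_mul]
    exact (norm_add_le _ _).trans (add_le_add (hC z) (hD z))

/-- Left multiplication by `w` on the pre-Hilbert space of `φ`. -/
noncomputable def preL (w : AlgCrossedProduct α) : φ.PreGNS →L[ℂ] φ.PreGNS :=
  LinearMap.mkContinuousOfExistsBound
    (φ.toPre.toLinearMap ∘ₗ LinearMap.mulLeft ℂ w ∘ₗ φ.toPre.symm.toLinearMap)
    (φ.exists_norm_mul_le w)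

/-- The GNS representation of `A[G]` for `φ`. -/
noncomputable def L (w : AlgCrossedProduct α) : φ.GNS →L[ℂ] φ.GNS := (φ.preL w).completion

theorem L_vec (w z : AlgCrossedProduct α) : φ.L w (φ.vec z) = φ.vec (w * z) :=
  ContinuousLinearMap.completion_apply_coe _ _

theorem L_one : φ.L 1 = 1 := operator_ext fun z => by rw [L_vec, one_mul]; rfl

theorem L_mul (w z : AlgCrossedProduct α) : φ.L (w * z) = φ.L w * φ.L z :=
  operator_ext fun x => by
    change _ = φ.L w (φ.L z _)
    rw [L_vec, L_vec, L_vec, mul_assoc]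

theorem L_add (w z : AlgCrossedProduct α) : φ.L (w + z) = φ.L w + φ.L z :=
  operator_ext fun x => by
    change _ = φ.L w _ + φ.L z _
    rw [L_vec, L_vec, L_vec, add_mul, vec_add]

theorem L_smul (c : ℂ) (w : AlgCrossedProduct α) : φ.L (c • w) = c • φ.L w :=
  operator_ext fun x => by
    change _ = c • φ.L w _
    rw [L_vec, L_vec, smul_mul_assoc, vec_smul]

theorem L_star (w : AlgCrossedProduct α) : φ.L (star w) = star (φ.L w) := by
  rw [ContinuousLinearMap.star_eq_adjoint, ContinuousLinearMap.eq_adjoint_iff]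
  intro x y
  induction x using vec_induction with
  | hc => exact isClosed_eq (by fun_prop) (by fun_prop)
  | h x =>
    induction y using vec_induction with
    | hc => exact isClosed_eq (by fun_prop) (by fun_prop)
    | h y => rw [L_vec, L_vec, inner_vec, inner_vec, star_mul, star_star, mul_assoc]

/-- The unitary of the GNS Hilbert space that represents `t ∈ G`. -/
noncomputable def unitaryL (t : G) : unitary (φ.GNS →L[ℂ] φ.GNS) :=
  ⟨φ.L (AlgCrossedProduct.single α t 1), by
    constructor <;>
    · rw [← L_star, ← L_mul, AlgCrossedProduct.star_single, AlgCrossedProduct.single_mul_single]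
      simp [← AlgCrossedProduct.one_def, L_one]⟩

theorem coe_unitaryL (t : G) :
    (φ.unitaryL t : φ.GNS →L[ℂ] φ.GNS) = φ.L (AlgCrossedProduct.single α t 1) := rfl

/-- The GNS representation of a positive functional on `A[G]`, as a covariant representation. -/
noncomputable def covariantRep : CovariantRep α where
  H := φ.GNS
  π :=
    { toFun a := φ.L (AlgCrossedProduct.single α 1 a)
      map_one' := by rw [← AlgCrossedProduct.one_def, L_one]
      map_mul' a b := by rw [← L_mul, AlgCrossedProduct.single_mul_single]; simp
      map_zero' := by
        rw [AlgCrossedProduct.single_zero, ← zero_smul ℂ (0 : AlgCrossedProduct α), L_smul,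
          zero_smul]
      map_add' a b := by rw [AlgCrossedProduct.single_add, L_add]
      commutes' c := by
        rw [Algebra.algebraMap_eq_smul_one, Algebra.algebraMap_eq_smul_one,
          ← AlgCrossedProduct.smul_single, ← AlgCrossedProduct.one_def, L_smul, L_one]
      map_star' a := by rw [← L_star, AlgCrossedProduct.star_single]; simp }
  U :=
    { toFun t := φ.unitaryL t
      map_one' := Subtype.ext (by rw [coe_unitaryL, ← AlgCrossedProduct.one_def, L_one]; rfl)
      map_mul' s t := Subtype.ext (by
        rw [Submonoid.coe_mul, coe_unitaryL, coe_unitaryL, coe_unitaryL, ← L_mul,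
          AlgCrossedProduct.single_mul_single]
        simp) }
  covariant t a := by
    change φ.L _ * φ.L _ = φ.L _ * φ.L _
    rw [← L_mul, ← L_mul, AlgCrossedProduct.single_mul_single, AlgCrossedProduct.single_mul_single]
    simp

theorem integrated_covariantRep (z : AlgCrossedProduct α) :
    φ.covariantRep.integrated z = φ.L z := by
  induction z using AlgCrossedProduct.induction with
  | hz =>
    rw [map_zero, ← zero_smul ℂ (0 : AlgCrossedProduct α), L_smul, zero_smul]
    rfl
  | hs t a =>
    rw [CovariantRep.integrated_single]
    change φ.L _ * φ.L _ = φ.L _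
    rw [← L_mul, AlgCrossedProduct.single_mul_single]
    simp
  | ha x y hx hy => rw [map_add, hx, hy, L_add]; rfl

/-- A positive functional on `A[G]` is bounded for the universal norm. -/
theorem norm_apply_le (z : AlgCrossedProduct α) : ‖φ.toLin z‖ ≤ ‖φ.vec 1‖ ^ 2 * ‖z‖ := by
  have h : φ.toLin z = ⟪φ.vec 1, φ.L z (φ.vec 1)⟫_ℂ := by
    rw [L_vec, inner_vec, star_one, one_mul, mul_one]
  have h1 : ‖φ.L z‖ ≤ ‖z‖ := by
    rw [← integrated_covariantRep]
    exact AlgCrossedProduct.norm_integrated_le _ z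
  rw [h]
  calc _ ≤ ‖φ.vec 1‖ * (‖φ.L z‖ * ‖φ.vec 1‖) :=
        (norm_inner_le_norm _ _).trans (by gcongr; exact (φ.L z).le_opNorm _)
    _ ≤ ‖φ.vec 1‖ * (‖z‖ * ‖φ.vec 1‖) := by gcongr
    _ = _ := by ring

/-- The continuous extension of a positive functional to `A ⋊ᵤ G`, as a continuous linear map. -/
noncomputable def extendCLM : CrossedProduct α →L[ℂ] ℂ :=
  (φ.toLin.mkContinuous _ φ.norm_apply_le).fromCompletion

theorem extendCLM_ofAlg (z : AlgCrossedProduct α) :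
    φ.extendCLM (CrossedProduct.ofAlg α z) = φ.toLin z :=
  ContinuousLinearMap.fromCompletion_apply_coe _ _

/-- The extension of a positive functional on `A[G]` to a positive functional on `A ⋊ᵤ G`. -/
noncomputable def extend : CrossedProduct α →ₚ[ℂ] ℂ :=
  PositiveLinearMap.mk₀ (φ.extendCLM : CrossedProduct α →ₗ[ℂ] ℂ) fun b hb => by
    obtain ⟨c, rfl⟩ := exists_eq_star_mul_self_of_nonneg hb
    clear hb
    change 0 ≤ φ.extendCLM (star c * c)
    induction c using CrossedProduct.induction with
    | hc =>
      have := CrossedProduct.continuous_star' α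
      exact isClosed_le continuous_const (φ.extendCLM.continuous.comp (this.mul continuous_id))
    | h z =>
      rw [CrossedProduct.star_ofAlg, ← map_mul, extendCLM_ofAlg]
      exact φ.nonneg' z

theorem extend_ι_mul_u (a : A) (t : G) :
    φ.extend (CrossedProduct.ι α a * CrossedProduct.u α t) =
      φ.toLin (AlgCrossedProduct.single α t a) := by
  rw [CrossedProduct.ι_mul_u]
  exact φ.extendCLM_ofAlg _

end AlgPositiveFunctional
end AlgebraicGNS

/-! ### From families to tracial states -/

section FamilyToTrace

open scoped InnerProductSpace ComplexOrder ComplexConjugate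

variable {A : Type u} {G : Type v} [CStarAlgebra A]

/-- Elements of `A[G]` in the form `∑ t⁻¹ cₜ`, for which the coefficients of `z^* z` are taken at
the group elements `s t⁻¹`. -/
theorem AlgCrossedProduct.exists_sum_single [Group G] {α : G →* (A ≃⋆ₐ[ℂ] A)}
    (z : AlgCrossedProduct α) :
    ∃ (E : Finset G) (c : G → A), z = ∑ t ∈ E, single α t⁻¹ (α t⁻¹ (c t)) := by
  obtain ⟨E, c, hz⟩ : ∃ (E : Finset G) (c : G → A), z = ∑ t ∈ E, single α t (c t) :=
    ⟨_, _, (SkewMonoidAlgebra.sum_single z).symm⟩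
  refine ⟨E.map (Equiv.inv G).toEmbedding, fun t => α t (c t⁻¹), ?_⟩
  rw [hz, Finset.sum_map]
  refine Finset.sum_congr rfl fun t _ => ?_
  have h : α t (α t⁻¹ (c t)) = c t := by
    rw [← StarAlgEquiv.mul_apply, ← map_mul]; simp
  simp only [Equiv.coe_toEmbedding, Equiv.inv_apply, inv_inv, h]

variable [PartialOrder A] [StarOrderedRing A] [Group G]
  {α : G →* (A ≃⋆ₐ[ℂ] A)} {τ : InvariantTrace α}

namespace InvariantTrace

theorem traceM_add (x y : τ.M) : τ.traceM (x + y) = τ.traceM x + τ.traceM y := by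
  rw [traceM, map_add]
  exact inner_add_right _ _ _

theorem traceM_smul (c : ℂ) (x : τ.M) : τ.traceM (c • x) = c * τ.traceM x := by
  rw [traceM, map_smul]
  exact inner_smul_right _ _ _

end InvariantTrace

namespace TraceFamily

open InvariantTrace

variable (X : TraceFamily τ)

/-- The values of the two matrix entries indexed by `(1, t)` and `(t, 1)` give `xₜ^* = x_{t⁻¹}`. -/
theorem star_x (t : G) : star (X.x t) = X.x t⁻¹ := by
  classical
  have h := (X.matrix_nonneg {1, t}).isSelfAdjoint
  have h1 := CStarMatrix.star_apply_of_isSelfAdjoint h (i := ⟨t, by simp⟩) (j := ⟨1, by simp⟩)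
  simpa using h1

/-- The functional `a t ↦ τ_M(π(a) xₜ)` on `A[G]`. -/
noncomputable def lin : AlgCrossedProduct α →ₗ[ℂ] ℂ where
  toFun := AlgCrossedProduct.liftAdd α fun t =>
    { toFun a := τ.traceM (τ.π a * X.x t)
      map_zero' := by rw [map_zero, zero_mul, ← zero_smul ℂ (0 : τ.M), traceM_smul, zero_mul]
      map_add' a b := by rw [map_add, add_mul, traceM_add] }
  map_add' := map_add _
  map_smul' c z := by
    induction z using AlgCrossedProduct.induction with
    | hz => simp
    | hs t a =>
      rw [AlgCrossedProduct.smul_single, AlgCrossedProduct.liftAdd_single,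
        AlgCrossedProduct.liftAdd_single]
      change τ.traceM _ = c * τ.traceM _
      rw [map_smul, smul_mul_assoc, traceM_smul]
    | ha z w hz hw => rw [smul_add, map_add, map_add, hz, hw, smul_add]

theorem lin_single (t : G) (a : A) :
    X.lin (AlgCrossedProduct.single α t a) = τ.traceM (τ.π a * X.x t) :=
  AlgCrossedProduct.liftAdd_single _ _ _ _

theorem lin_star (z : AlgCrossedProduct α) : X.lin (star z) = conj (X.lin z) := by
  induction z using AlgCrossedProduct.induction with
  | hz => simp
  | hs t a =>
    rw [AlgCrossedProduct.star_single, lin_single, lin_single, ← traceM_star, star_mul, X.star_x,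
      ← map_star, X.mul_eq, action_π]
  | ha z w hz hw => rw [star_add, map_add, map_add, hz, hw, map_add]

/-- For `z = ∑ t⁻¹ cₜ` the value at `z^* z` is `∑ ⟨c_s, x_{s t⁻¹} c_t⟩`, the matrix `[x_{s t⁻¹}]`
as a form on vectors of `H_τ`. -/
theorem lin_nonneg (z : AlgCrossedProduct α) : 0 ≤ X.lin (star z * z) := by
  obtain ⟨E, c, rfl⟩ := z.exists_sum_single
  have h := CStarMatrix.sum_inner_nonneg τ.incl (X.matrix_nonneg E) fun t => τ.vec (c t)
  convert h using 1
  rw [star_sum, Finset.sum_mul_sum, map_sum, ← Finset.sum_coe_sort]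
  refine Finset.sum_congr rfl fun s _ => ?_
  rw [map_sum, ← Finset.sum_coe_sort]
  refine Finset.sum_congr rfl fun t _ => ?_
  have hs : α (s : G) (α (s : G)⁻¹ (star (c s))) = star (c s) := by
    rw [← StarAlgEquiv.mul_apply, ← map_mul]; simp
  rw [AlgCrossedProduct.star_single, AlgCrossedProduct.single_mul_single, lin_single, inv_inv,
    ← map_star, hs, ← StarAlgEquiv.mul_apply, ← map_mul, map_mul, mul_assoc, ← action_π,
    ← X.mul_eq, traceM_π_mul, star_star, incl_mul_apply, incl_π]
  exact congrArg _ (congrArg _ (τ.gns_ξ _))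

/-- The positive functional `a t ↦ τ_M(π(a) xₜ)` on `A[G]`. -/
noncomputable def functional : AlgPositiveFunctional α where
  toLin := X.lin
  map_star' := X.lin_star
  nonneg' := X.lin_nonneg

theorem extend_functional (a : A) (t : G) :
    X.functional.extend (CrossedProduct.ι α a * CrossedProduct.u α t) =
      τ.traceM (τ.π a * X.x t) := by
  rw [AlgPositiveFunctional.extend_ι_mul_u]
  exact X.lin_single t a

theorem lin_mul_comm (s t : G) (a b : A) :
    X.lin (AlgCrossedProduct.single α s a * AlgCrossedProduct.single α t b) =
      X.lin (AlgCrossedProduct.single α t b * AlgCrossedProduct.single α s a) := by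
  rw [AlgCrossedProduct.single_mul_single, AlgCrossedProduct.single_mul_single, lin_single,
    lin_single, ← traceM_action s (τ.π (b * α t a) * X.x (t * s)), map_mul (τ.action s),
    X.action_eq, action_π, map_mul (α s), ← StarAlgEquiv.mul_apply, ← map_mul α,
    map_mul τ.π (α s b), mul_assoc, ← τ.action_π (s * t)]
  have h : s * (t * s) * s⁻¹ = s * t := by group
  rw [h, ← X.mul_eq, map_mul τ.π, mul_assoc, traceM_mul_comm, mul_assoc]

/-- The tracial state `σ(a t) = τ_M(π(a) xₜ)` of a family `{xₜ}`. -/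
noncomputable def toTracialExtension : TracialExtension τ where
  toPositive := X.functional.extend
  map_one' := by
    have h := X.extend_functional 1 1
    rwa [CrossedProduct.u_one, map_one, map_one, X.one, mul_one, mul_one, ← map_one τ.π, traceM_π,
      τ.map_one'] at h
  map_mul_comm' z w := by
    have hc := map_continuous X.functional.extend
    induction z using CrossedProduct.induction_ι_mul_u with
    | hc => exact isClosed_eq (by fun_prop) (by fun_prop)
    | ha x y hx hy => rw [add_mul, mul_add, map_add, map_add, hx, hy]
    | h a s =>
      induction w using CrossedProduct.induction_ι_mul_u with
      | hc => exact isClosed_eq (by fun_prop) (by fun_prop)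
      | ha x y hx hy => rw [add_mul, mul_add, map_add, map_add, hx, hy]
      | h b t =>
        rw [CrossedProduct.ι_mul_u, CrossedProduct.ι_mul_u, ← map_mul, ← map_mul]
        refine (AlgPositiveFunctional.extendCLM_ofAlg _ _).trans
          (Eq.trans ?_ (AlgPositiveFunctional.extendCLM_ofAlg _ _).symm)
        exact X.lin_mul_comm s t a b
  map_ι a := by
    have h := X.extend_functional a 1
    rwa [CrossedProduct.u_one, X.one, mul_one, mul_one, traceM_π] at h

end TraceFamily

end FamilyToTrace

/-! ### From tracial states to pseudoexpectations -/

section TraceToPseudoexpectation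

open UniformSpace ContinuousLinearMap
open scoped InnerProductSpace ComplexOrder

variable {A : Type u} {G : Type v} [CStarAlgebra A] [PartialOrder A] [StarOrderedRing A] [Group G]
  {α : G →* (A ≃⋆ₐ[ℂ] A)} {τ : InvariantTrace α}

namespace TracialExtension

variable (σ : TracialExtension τ)

/-- The class in `H_σ` of an element of `A ⋊ᵤ G`. -/
noncomputable def vec (b : CrossedProduct α) : σ.toPositive.GNS :=
  ((σ.toPositive.toPreGNS b : σ.toPositive.PreGNS) : σ.toPositive.GNS)

theorem inner_vec (b c : CrossedProduct α) :
    ⟪σ.vec b, σ.vec c⟫_ℂ = σ.toPositive (star b * c) := gns_inner_coe _ b c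

theorem gns_vec (b c : CrossedProduct α) :
    σ.toPositive.gnsStarAlgHom b (σ.vec c) = σ.vec (b * c) := gnsStarAlgHom_coe _ b c

/-- The isometry of pre-Hilbert spaces given by the inclusion of `A` in `A ⋊ᵤ G`. -/
noncomputable def preV : τ.toPositive.PreGNS →ₗᵢ[ℂ] σ.toPositive.PreGNS where
  toLinearMap := σ.toPositive.toPreGNS.toLinearMap ∘ₗ
    (CrossedProduct.ι α : A →ₗ[ℂ] CrossedProduct α) ∘ₗ τ.toPositive.ofPreGNS.toLinearMap
  norm_map' x := by
    simp only [PositiveLinearMap.preGNS_norm_def, LinearMap.comp_apply, LinearEquiv.coe_coe,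
      PositiveLinearMap.ofPreGNS_toPreGNS]
    change √(σ.toPositive (star (CrossedProduct.ι α _) * CrossedProduct.ι α _)).re = _
    rw [← map_star, ← map_mul, σ.map_ι]

/-- The isometry `H_τ → H_σ` that extends the inclusion of `A` in `A ⋊ᵤ G`. -/
noncomputable def V : τ.H →L[ℂ] σ.toPositive.GNS := σ.preV.toContinuousLinearMap.completion

theorem V_vec (a : A) : σ.V (τ.vec a) = σ.vec (CrossedProduct.ι α a) :=
  ContinuousLinearMap.completion_apply_coe _ _

/-- The compression to `H_τ` of the GNS representation of `A ⋊ᵤ G` on `H_σ`. -/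
noncomputable def compress (b : CrossedProduct α) : τ.H →L[ℂ] τ.H :=
  (σ.V).adjoint ∘L σ.toPositive.gnsStarAlgHom b ∘L σ.V

theorem inner_compress (b : CrossedProduct α) (x y : τ.H) :
    ⟪x, σ.compress b y⟫_ℂ = ⟪σ.V x, σ.toPositive.gnsStarAlgHom b (σ.V y)⟫_ℂ :=
  adjoint_inner_right σ.V x _

theorem inner_vec_compress (b : CrossedProduct α) (a c : A) :
    ⟪τ.vec a, σ.compress b (τ.vec c)⟫_ℂ =
      σ.toPositive (star (CrossedProduct.ι α a) * (b * CrossedProduct.ι α c)) := by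
  rw [inner_compress, V_vec, V_vec, gns_vec, inner_vec]

/-- The trace property of `σ`, in the form `σ((a d)^* b c) = σ(a^* b (c d^*))`. -/
theorem commute_R_compress (b : CrossedProduct α) (d : A) : Commute (τ.R d) (σ.compress b) := by
  refine InvariantTrace.operator_ext fun a c => ?_
  change ⟪τ.vec a, τ.R d (σ.compress b (τ.vec c))⟫_ℂ = ⟪τ.vec a, σ.compress b (τ.R d (τ.vec c))⟫_ℂ
  rw [← star_star d, ← τ.inner_R, τ.R_vec, τ.R_vec, inner_vec_compress, inner_vec_compress,
    star_star, ← map_star, star_mul, map_mul (CrossedProduct.ι α),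
    map_mul (CrossedProduct.ι α), mul_assoc, σ.map_mul_comm', map_star]
  simp only [map_star, mul_assoc]

theorem compress_mem (b : CrossedProduct α) :
    σ.compress b ∈ (gnsVonNeumann τ.toPositive).toStarSubalgebra :=
  InvariantTrace.mem_of_commute_R (σ.commute_R_compress b)

/-- The compression of the GNS representation of `A ⋊ᵤ G`, as a map into `M`. -/
noncomputable def toM : CrossedProduct α →ₗ[ℂ] τ.M where
  toFun b := ⟨σ.compress b, σ.compress_mem b⟩
  map_add' b c := Subtype.ext <| by
    change σ.compress (b + c) = σ.compress b + σ.compress c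
    rw [compress, map_add, add_comp, comp_add]; rfl
  map_smul' z b := Subtype.ext <| by
    change σ.compress (z • b) = z • σ.compress b
    rw [compress, map_smul, smul_comp, comp_smul]; rfl

theorem incl_toM (b : CrossedProduct α) : τ.incl (σ.toM b) = σ.compress b := rfl

theorem eq_toM {y : τ.M} {b : CrossedProduct α}
    (h : ∀ a c, ⟪τ.vec a, τ.incl y (τ.vec c)⟫_ℂ =
      σ.toPositive (star (CrossedProduct.ι α a) * (b * CrossedProduct.ι α c))) : σ.toM b = y :=
  InvariantTrace.incl_injective <| InvariantTrace.operator_ext fun a c => by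
    rw [incl_toM, inner_vec_compress, h]

theorem toM_ι (a : A) : σ.toM (CrossedProduct.ι α a) = τ.π a :=
  σ.eq_toM fun b c => by
    rw [← map_star, ← map_mul, ← map_mul, σ.map_ι, ← τ.inner_vec, ← τ.gns_vec]
    rfl

theorem toM_star (b : CrossedProduct α) : σ.toM (star b) = star (σ.toM b) :=
  InvariantTrace.incl_injective <| by
    rw [map_star τ.incl, incl_toM, incl_toM, compress, compress, map_star, star_eq_adjoint,
      star_eq_adjoint, adjoint_comp, adjoint_comp, adjoint_adjoint]
    rfl

theorem toM_matrix_nonneg {n : Type*} [Fintype n] {N : CStarMatrix n n (CrossedProduct α)}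
    (hN : 0 ≤ N) : 0 ≤ N.map σ.toM := by
  refine CStarMatrix.nonneg_of_sum_inner_nonneg τ.incl InvariantTrace.incl_injective ?_ fun h => ?_
  · ext i j
    rw [CStarMatrix.star_apply, CStarMatrix.map_apply, CStarMatrix.map_apply, ← toM_star,
      CStarMatrix.star_apply_of_isSelfAdjoint hN.isSelfAdjoint]
  · have := CStarMatrix.sum_inner_nonneg σ.toPositive.gnsStarAlgHom hN fun i => σ.V (h i)
    simpa only [CStarMatrix.map_apply, incl_toM, inner_compress] using this

theorem toM_equivariant (s : G) (b : CrossedProduct α) :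
    σ.toM (CrossedProduct.action α s b) = τ.action s (σ.toM b) := by
  refine σ.eq_toM fun a c => ?_
  have hU : ⟪τ.vec a, τ.incl (τ.action s (σ.toM b)) (τ.vec c)⟫_ℂ =
      ⟪τ.vec (α s⁻¹ a), σ.compress b (τ.vec (α s⁻¹ c))⟫_ℂ := by
    rw [τ.incl_action, ← incl_toM, ← (τ.U s⁻¹).inner_map_map, τ.U_symm, ← τ.U_mul, inv_mul_cancel,
      τ.U_one, InvariantTrace.U_vec, InvariantTrace.U_vec]
  have hconj (d : A) : CrossedProduct.ι α (α s⁻¹ d) =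
      star (CrossedProduct.u α s : CrossedProduct α) * CrossedProduct.ι α d *
        (CrossedProduct.u α s : CrossedProduct α) := by
    rw [CrossedProduct.star_u, CrossedProduct.u_mul_ι, mul_assoc, CrossedProduct.u_mul_u,
      inv_mul_cancel, CrossedProduct.u_one, mul_one]
  rw [hU, inner_vec_compress, hconj, hconj, star_mul, star_mul, star_star, mul_assoc,
    σ.map_mul_comm', CrossedProduct.action, Unitary.conjStarAlgAut_apply]
  have h1 : (CrossedProduct.u α s : CrossedProduct α) *
      star (CrossedProduct.u α s : CrossedProduct α) = 1 := Unitary.coe_mul_star_self _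
  simp only [mul_assoc, h1, mul_one]

/-- The pseudoexpectation of a tracial extension: the compression of its GNS representation to the
closure of the image of `A`. -/
noncomputable def toPseudoexpectation : Pseudoexpectation τ where
  toLinearMap := σ.toM
  map_cstarMatrix_nonneg' k N hN := σ.toM_matrix_nonneg hN
  map_one' := by rw [← map_one (CrossedProduct.ι α), toM_ι, map_one]
  equivariant := σ.toM_equivariant
  map_ι := σ.toM_ι

theorem traceM_toPseudoexpectation (a : A) (t : G) :
    τ.traceM (τ.π a * σ.toPseudoexpectation (CrossedProduct.u α t)) =
      σ.toPositive (CrossedProduct.ι α a * CrossedProduct.u α t) := by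
  rw [← Pseudoexpectation.map_ι_mul]
  refine (σ.inner_vec_compress _ 1 1).trans ?_
  rw [map_one, star_one, one_mul, mul_one]

variable {σ} in
theorem ext_ι_mul_u {σ' : TracialExtension τ}
    (h : ∀ (a : A) (t : G), σ.toPositive (CrossedProduct.ι α a * CrossedProduct.u α t) =
      σ'.toPositive (CrossedProduct.ι α a * CrossedProduct.u α t)) : σ = σ' := by
  have h1 : σ.toPositive = σ'.toPositive := by
    ext x
    induction x using CrossedProduct.induction_ι_mul_u with
    | hc => exact isClosed_eq (map_continuous _) (map_continuous _)
    | ha x y hx hy => rw [map_add, map_add, hx, hy]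
    | h a t => exact h a t
  cases σ with | mk σ _ =>
  cases σ' with | mk σ' _ =>
  cases σ; cases σ'
  congr

end TracialExtension

theorem Pseudoexpectation.toFamily_bijective :
    Function.Bijective (Pseudoexpectation.toFamily (τ := τ)) := by
  refine ⟨fun F F' h => Pseudoexpectation.ext_u fun t => congrArg (fun X => X.x t) h, fun X => ?_⟩
  refine ⟨X.toTracialExtension.toPseudoexpectation, ?_⟩
  have h : (X.toTracialExtension.toPseudoexpectation.toFamily).x = X.x := by
    funext t
    refine InvariantTrace.eq_of_traceM_π_mul fun a => ?_
    exact (X.toTracialExtension.traceM_toPseudoexpectation a t).trans (X.extend_functional a t)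
  generalize X.toTracialExtension.toPseudoexpectation.toFamily = Y at h
  cases X; cases Y
  congr

theorem TraceFamily.toTracialExtension_bijective :
    Function.Bijective (TraceFamily.toTracialExtension (τ := τ)) := by
  refine ⟨fun X Y h => ?_, fun σ => ?_⟩
  · have h1 : X.x = Y.x := by
      funext t
      refine InvariantTrace.eq_of_traceM_π_mul fun a => ?_
      rw [← X.extend_functional, ← Y.extend_functional]
      exact congrArg (fun σ : TracialExtension τ => σ.toPositive _) h
    cases X; cases Y
    congr
  · refine ⟨σ.toPseudoexpectation.toFamily, TracialExtension.ext_ι_mul_u fun a t => ?_⟩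
    exact (TraceFamily.extend_functional _ a t).trans (σ.traceM_toPseudoexpectation a t)

end TraceToPseudoexpectation

theorem theorem1p1 {A : Type u} {G : Type v} [CStarAlgebra A] [PartialOrder A]
    [StarOrderedRing A] [Group G] (α : G →* (A ≃⋆ₐ[ℂ] A)) (τ : InvariantTrace α) :
    ∃ (Φ : Pseudoexpectation τ ≃ TraceFamily τ) (Ψ : TraceFamily τ ≃ TracialExtension τ),
      (∀ (F : Pseudoexpectation τ) (t : G), (Φ F).x t = F (CrossedProduct.u α t)) ∧
      ∀ (X : TraceFamily τ) (a : A) (t : G),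
        (Ψ X).toPositive (CrossedProduct.ι α a * CrossedProduct.u α t) =
          τ.traceM (τ.π a * X.x t) :=
  ⟨Equiv.ofBijective _ Pseudoexpectation.toFamily_bijective,
    Equiv.ofBijective _ TraceFamily.toTracialExtension_bijective, fun _ _ => rfl,
    fun X a t => X.extend_functional a t⟩
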